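/- Let $N\ge 1$ and $0<s<1$, put $\mathcal X=L^1(\mathbb R^N)\cap L^\infty(\mathbb R^N)$ and $\mathcal L=-\Delta+(-\Delta)^s$. Let $$\mathfrak h^{(s)}_t(x)=(2\pi)^{-N}\int_{\mathbb R^N}e^{i x\cdot\xi-t|\xi|^{2s}}\,d\xi,\qquad \mathfrak p_t(z)=(4\pi t)^{-N/2}\int_{\mathbb R^N}e^{-|z-\xi|^2/(4t)}\,\mathfrak h^{(s)}_t(\xi)\,d\xi$$ be the heat kernels of $-(-\Delta)^s$ and of $-\mathcal L$, and let $[e^{-t\mathcal L}v](x)=\int_{\mathbb R^N}\mathfrak p_t(x-y)v(y)\,dy$ for $t>0$, $v\in\mathcal X$. Let $h,f:[0,\infty)\to[0,\infty)$ be continuous, with $f$ locally Lipschitz and $f(0)=0$. For $0\le u_0\in\mathcal X$ and $0<T\le\infty$, a mild solution on $[0,T)$ of $$u_t+\mathcal L u=h(t)f(u),\qquad u(0)=u_0 \qquad (1)$$ is a function $u:\mathbb R^N\times[0,T)\to[0,\infty)$ with $u\in L^\infty((0,T);\mathcal X)$ and $$u(t)=e^{-t\mathcal L}u_0+\int_0^t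 e^{-(t-\sigma)\mathcal L}\,h(\sigma)f(u(\sigma))\,d\sigma\quad\text{for } 0<t<T$$ (equality almost everywhere on $\mathbb R^N$); it is called global if $T=\infty$. We say that mild solutions of (1) are unique if any two of them, on $[0,T_1)$ and on $[0,T_2)$, coincide almost everywhere on $\mathbb R^N$ at each time $0<t<\min\{T_1,T_2\}$. (i) Suppose that $f(r)$ and $f(r)/r$ are nondecreasing on an interval $(0,m]$ and that there is $0\le v_0\in\mathcal X$, $v_0\ne0$, with $\|v_0\|_\infty\le m$ and $$\int_0^\infty h(\sigma)\,\frac{f(\|e^{-\sigma\mathcal L}v_0\|_\infty)}{\|e^{-\sigma\mathcal L}v_0\|_\infty}\,d\sigma<1 .$$ Then there is $\delta>0$ such that for $u_0=\delta v_0$ mild solutions of (1) are unique and (1) has a nontrivial global mild solution. (ii) Let $0\le u_0\in\mathcal X$, $u_0\neq0$. Suppose that $f$ is nondecreasing with $f(r)>0$ for all $r>0$, that $\int_{z}^\infty \frac{d\sigma}{f(\sigma)}<\infty$ for all $z>0$, and that $f(e^{-t\mathcal L}w)\le e^{-t\mathcal L}f(w)$ for all $t>0$ and all $0\le w\in\mathcal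 X$. If for some $\kappa>0$ $$\int_{\|e^{-\kappa\mathcal L}u_0\|_\infty}^\infty\frac{d\sigma}{f(\sigma)}\le\int_0^\kappa h(\sigma)\,d\sigma ,$$ then the mild solution of (1) is not global: a mild solution exists on $[0,T)$ for some $T>0$, mild solutions are unique, every mild solution on an interval $[0,T)$ has $T\le\kappa$, and in particular there is no global mild solution. -/

import Mathlib

open MeasureTheory Set
open scoped FourierTransform ENNReal

noncomputable section

namespace MixedHeat

/-- Euclidean space `ℝ^N`. -/
abbrev E (N : ℕ) : Type := EuclideanSpace ℝ (Fin N)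

/-- The class `C([0,∞))` of nonnegative continuous functions on `[0,∞)`; the values of `g` at
negative arguments play no role. -/
def NonnegCont (g : ℝ → ℝ) : Prop :=
  ContinuousOn g (Ici 0) ∧ ∀ r : ℝ, 0 ≤ r → 0 ≤ g r

/-- Membership in `𝒳 = L^1(ℝ^N) ∩ L^∞(ℝ^N)`. -/
def MemX {N : ℕ} (v : E N → ℝ) : Prop :=
  MemLp v 1 volume ∧ MemLp v ∞ volume

/-- `0 ≤ v` and `v ∈ 𝒳`. -/
def NonnegX {N : ℕ} (v : E N → ℝ) : Prop :=
  MemX v ∧ ∀ᵐ x : E N, 0 ≤ v x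

/-- The essential supremum norm `‖v‖_∞` (for `v ∈ L^∞(ℝ^N)`). -/
def supNorm {N : ℕ} (v : E N → ℝ) : ℝ :=
  (eLpNorm v ∞ (volume : Measure (E N))).toReal

/-- The heat kernel of `-(-Δ)^s` on `ℝ^N`: the inverse Fourier transform of the symbol
`exp (-t |2πξ|^(2s))` (Mathlib's Fourier transform has the character `exp (2πi⟨x, ξ⟩)`).
The symbol is even, so the transform is real. -/
def fracHeatKernel {N : ℕ} (s t : ℝ) (x : E N) : ℝ :=
  (𝓕⁻ (fun ξ : E N => ((Real.exp (-t * (2 * Real.pi * ‖ξ‖) ^ (2 * s)) : ℝ) : ℂ)) x).re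

/-- The heat kernel `𝔭_t` of `-ℒ`, `ℒ = -Δ + (-Δ)^s`: the Gaussian heat kernel convolved with
the fractional heat kernel (for `t > 0`). -/
def mixedHeatKernel {N : ℕ} (s t : ℝ) (z : E N) : ℝ :=
  1 / (4 * Real.pi * t) ^ ((N : ℝ) / 2) *
    ∫ ξ : E N, Real.exp (-(‖z - ξ‖ ^ 2 / (4 * t))) * fracHeatKernel s t ξ

/-- The heat semigroup `e^{-tℒ}`, given by convolution with `𝔭_t` for `t > 0` and equal to
the identity at `t = 0`. -/
def semigroup {N : ℕ} (s t : ℝ) (v : E N → ℝ) (x : E N) : ℝ :=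
  if 0 < t then ∫ y : E N, mixedHeatKernel s t (x - y) * v y else v x

/-- The open time interval `(0,T)`, where `T ∈ (0,∞]`. -/
def timeInterval (T : EReal) : Set ℝ := {t : ℝ | 0 < t ∧ (t : EReal) < T}

/-- `u ∈ L^∞((0,T); 𝒳)`: `u` is (a.e.) jointly measurable, `u(t) ∈ 𝒳` for every `t`, and the
norms of `u(t)` in `L^1` and `L^∞` are essentially bounded on `(0,T)`. -/
def MemLinftyX {N : ℕ} (T : EReal) (u : ℝ → E N → ℝ) : Prop :=
  AEStronglyMeasurable (fun q : ℝ × E N => u q.1 q.2)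
      ((volume.restrict (timeInterval T)).prod volume) ∧
  (∀ t ∈ timeInterval T, MemX (u t)) ∧
  ∃ M : ℝ, ∀ᵐ t ∂(volume.restrict (timeInterval T)),
    eLpNorm (u t) 1 volume ≤ ENNReal.ofReal M ∧ eLpNorm (u t) ∞ volume ≤ ENNReal.ofReal M

/-- `u` is a mild solution on `ℝ^N × [0,T)` of `u_t + ℒu = h(t) f(u)`, `u(0) = u₀`. The
identity between elements of `𝒳` is an equality for almost every `x`, at every `t ∈ (0,T)`. -/
def IsMildSolution {N : ℕ} (s : ℝ) (h f : ℝ → ℝ) (u₀ : E N → ℝ) (T : EReal)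
    (u : ℝ → E N → ℝ) : Prop :=
  (∀ t : ℝ, 0 ≤ t → (t : EReal) < T → ∀ x, 0 ≤ u t x) ∧
  MemLinftyX T u ∧
  ∀ t ∈ timeInterval T, ∀ᵐ x : E N,
    u t x = semigroup s t u₀ x +
      ∫ σ in (0 : ℝ)..t, semigroup s (t - σ) (fun y => h σ * f (u σ y)) x

/-- A global mild solution: `T = +∞`. -/
def IsGlobalMildSolution {N : ℕ} (s : ℝ) (h f : ℝ → ℝ) (u₀ : E N → ℝ)
    (u : ℝ → E N → ℝ) : Prop :=
  IsMildSolution s h f u₀ ⊤ u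

/-- Mild solutions with initial data `u₀` are unique: any two of them, on `[0,T₁)` and on
`[0,T₂)`, coincide at all common positive times. -/
def MildSolutionsUnique {N : ℕ} (s : ℝ) (h f : ℝ → ℝ) (u₀ : E N → ℝ) : Prop :=
  ∀ (T₁ T₂ : EReal) (u₁ u₂ : ℝ → E N → ℝ),
    IsMildSolution s h f u₀ T₁ u₁ → IsMildSolution s h f u₀ T₂ u₂ →
    ∀ t : ℝ, t ∈ timeInterval T₁ → t ∈ timeInterval T₂ → u₁ t =ᵐ[volume] u₂ t

/-- `u` is not the zero element of `L^∞((0,∞); 𝒳)`. -/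
def IsNontrivial {N : ℕ} (u : ℝ → E N → ℝ) : Prop :=
  ¬ ∀ᵐ t ∂(volume.restrict (Ioi (0 : ℝ))), u t =ᵐ[volume] 0

end MixedHeat

end

noncomputable section

namespace MixedHeat

open Filter Topology Real
open scoped RealInnerProductSpace

variable {N : ℕ}

/-! Everything rests on four facts about the mixed kernel: it is nonnegative, bounded and
continuous, has mass one, and satisfies the semigroup law. All are read off its symbol, a Gaussian
times `exp (-t |2πξ|^(2s))`. Positivity is the delicate one (`mixedHeatKernel_nonneg`): since `r ^
s` is a mixture of the functions `1 - exp (-μ r)`, the fractional factor is a limit of nonnegative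
combinations of Gaussian mixtures, and Gaussians have positive transforms. Given positivity, the
analysis is done with `[0, ∞]`-valued functions, where Tonelli and monotone convergence apply
freely.

Uniqueness (`mildSolutionsUnique`) iterates the Lipschitz estimate and gains a factorial at each
step. Existence is monotone iteration below a supersolution
(`exists_mildSolution_of_supersolution`). For (i) the supersolution is `S(t) v₀` itself, where
`S(t)` denotes the semigroup: monotonicity of `f(r)/r` bounds `f(S(σ) v₀)` by a scalar times `S(σ)
v₀`, so the Duhamel term is at most `I · S(t) v₀`, with `I < 1` the integral in the hypothesis; data
`(1 - I) v₀` leave exactly enough room. For local existence in (ii) it is `exp (C t) S(t) u₀`.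

For nonexistence, suppose `u` lives past `κ` and put `G(t, x) = [S(κ - t) u(t)](x)`. Jensen's
inequality gives `G(t) ≥ A + ∫₀ᵗ h f(G)` with `A = [S(κ) u₀](x)`, hence `∫₀^κ h ≤ ∫_A^{G(κ)} 1/f`
(`integral_le_integral_one_div`). As `G(κ, x) = u(κ, x)` is essentially bounded, a fixed tail of `∫
1/f` is never used. The hypothesis is a non-strict inequality at the essential supremum `K` of `S(κ)
u₀`, which need not be attained; the lost tail, uniform in `x`, keeps `A` a fixed distance below `K`
almost everywhere (`exists_gap`), contradicting the choice of `K`. -/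

/-! ### Positivity of cosine transforms and Gaussian mixtures -/

theorem integrable_exp_neg_mul_sq {b : ℝ} (hb : 0 < b) :
    Integrable (fun ξ : E N => Real.exp (-b * ‖ξ‖ ^ 2)) := by
  have h := (GaussianFourier.integrable_cexp_neg_mul_sq_norm_add (V := E N) (b := b)
    (by simpa using hb) 0 0).norm
  refine h.congr (ae_of_all _ fun ξ => ?_)
  simp only [Complex.norm_exp]
  norm_num [← Complex.ofReal_pow]

/-- Bounded measurable functions whose products with all centred Gaussians have a nonnegative
cosine transform. -/
structure GaussPos (G : E N → ℝ) : Prop where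
  meas : Measurable G
  bdd : ∃ C, ∀ ξ, |G ξ| ≤ C
  nonneg : ∀ b : ℝ, 0 < b → ∀ x : E N,
    0 ≤ ∫ ξ, Real.cos (2 * π * ⟪ξ, x⟫) * Real.exp (-b * ‖ξ‖ ^ 2) * G ξ

theorem measurable_cos_mul_exp (b : ℝ) (x : E N) :
    Measurable fun ξ : E N => Real.cos (2 * π * ⟪ξ, x⟫) * Real.exp (-b * ‖ξ‖ ^ 2) := by
  fun_prop

theorem abs_cos_mul_exp_mul_le (θ r g C : ℝ) (hg : |g| ≤ C) :
    |Real.cos θ * Real.exp r * g| ≤ Real.exp r * C := by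
  rw [abs_mul, abs_mul, abs_of_pos (Real.exp_pos r)]
  have h1 := Real.abs_cos_le_one θ
  have h2 := Real.exp_pos r
  have : |Real.cos θ| * Real.exp r ≤ Real.exp r := by nlinarith
  exact mul_le_mul this hg (abs_nonneg _) h2.le

theorem integrable_cos_mul_exp_mul {G : E N → ℝ} (hm : Measurable G) {C : ℝ}
    (hC : ∀ ξ, |G ξ| ≤ C) {b : ℝ} (hb : 0 < b) (x : E N) :
    Integrable fun ξ : E N => Real.cos (2 * π * ⟪ξ, x⟫) * Real.exp (-b * ‖ξ‖ ^ 2) * G ξ := by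
  refine ((integrable_exp_neg_mul_sq hb).mul_const C).mono'
    ((measurable_cos_mul_exp b x).mul hm).aestronglyMeasurable (ae_of_all _ fun ξ => ?_)
  exact abs_cos_mul_exp_mul_le _ _ _ _ (hC ξ)

theorem re_exp_mul_I_smul (θ r : ℝ) :
    (Complex.exp ((θ : ℂ) * Complex.I) • (r : ℂ)).re = Real.cos θ * r := by
  simp [Complex.exp_ofReal_mul_I_re]

theorem im_exp_mul_I_smul (θ r : ℝ) :
    (Complex.exp ((θ : ℂ) * Complex.I) • (r : ℂ)).im = Real.sin θ * r := by
  simp [Complex.exp_ofReal_mul_I_im]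

/-- The Fourier transform of a Gaussian is a positive Gaussian, and its real part is the cosine
transform. -/
theorem GaussPos.one : GaussPos (fun _ : E N => (1 : ℝ)) where
  meas := measurable_const
  bdd := ⟨1, fun _ => by simp⟩
  nonneg b hb x := by
    have h := fourier_gaussian_innerProductSpace (V := E N) (b := b) (by simpa using hb) x
    have hi : Integrable fun ξ : E N => Complex.exp (((-2 * π * ⟪ξ, x⟫ : ℝ) : ℂ) * Complex.I) •
        Complex.exp (-(b : ℂ) * ‖ξ‖ ^ 2) := by
      refine (integrable_exp_neg_mul_sq (N := N) hb).mono'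
        (Continuous.aestronglyMeasurable (by fun_prop)) (ae_of_all _ fun ξ => ?_)
      rw [norm_smul, Complex.norm_exp_ofReal_mul_I, one_mul, Complex.norm_exp]
      norm_num [← Complex.ofReal_pow]
    have h2 := congrArg Complex.re h
    rw [Real.fourier_eq', ← Complex.reCLM_apply, ← Complex.reCLM.integral_comp_comm hi] at h2
    have h3 : ∀ ξ : E N, Complex.reCLM (Complex.exp (((-2 * π * ⟪ξ, x⟫ : ℝ) : ℂ) * Complex.I) •
        Complex.exp (-(b : ℂ) * ‖ξ‖ ^ 2)) =
        Real.cos (2 * π * ⟪ξ, x⟫) * Real.exp (-b * ‖ξ‖ ^ 2) * 1 := by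
      intro ξ
      rw [show -(b : ℂ) * (‖ξ‖ : ℂ) ^ 2 = ((-b * ‖ξ‖ ^ 2 : ℝ) : ℂ) by push_cast; ring,
        ← Complex.ofReal_exp, Complex.reCLM_apply, re_exp_mul_I_smul, mul_one, neg_mul, neg_mul,
        Real.cos_neg]
    simp_rw [h3] at h2
    rw [h2]
    have h4 : ((π : ℂ) / b) ^ ((Module.finrank ℝ (E N) : ℂ) / 2) *
        Complex.exp (-(π : ℂ) ^ 2 * ‖x‖ ^ 2 / b) =
        (((π / b) ^ ((Module.finrank ℝ (E N) : ℝ) / 2) *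
          Real.exp (-π ^ 2 * ‖x‖ ^ 2 / b) : ℝ) : ℂ) := by
      push_cast [Complex.ofReal_cpow (div_nonneg pi_pos.le hb.le)]
      rfl
    rw [h4, Complex.ofReal_re]
    positivity

/-- Dominated convergence: the Gaussian weight turns the uniform bound `C` into an integrable
majorant. -/
theorem GaussPos.of_tendsto {G : ℕ → E N → ℝ} {H : E N → ℝ} (hG : ∀ n, GaussPos (G n)) {C : ℝ}
    (hC : ∀ n ξ, |G n ξ| ≤ C) (hlim : ∀ ξ, Tendsto (fun n => G n ξ) atTop (𝓝 (H ξ))) :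
    GaussPos H where
  meas := measurable_of_tendsto_metrizable (fun n => (hG n).meas) (tendsto_pi_nhds.2 hlim)
  bdd := ⟨C, fun ξ => le_of_tendsto' (hlim ξ).abs fun n => hC n ξ⟩
  nonneg b hb x := by
    refine ge_of_tendsto' (tendsto_integral_of_dominated_convergence
      (F := fun n ξ => Real.cos (2 * π * ⟪ξ, x⟫) * Real.exp (-b * ‖ξ‖ ^ 2) * G n ξ)
      (fun ξ => Real.exp (-b * ‖ξ‖ ^ 2) * C)
      (fun n => ((measurable_cos_mul_exp b x).mul (hG n).meas).aestronglyMeasurable)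
      ((integrable_exp_neg_mul_sq hb).mul_const C)
      (fun n => ae_of_all _ fun ξ => abs_cos_mul_exp_mul_le _ _ _ _ (hC n ξ))
      (ae_of_all _ fun ξ => (hlim ξ).const_mul _)) fun n => (hG n).nonneg b hb x

theorem GaussPos.add {G H : E N → ℝ} (hG : GaussPos G) (hH : GaussPos H) :
    GaussPos (fun ξ => G ξ + H ξ) where
  meas := hG.meas.add hH.meas
  bdd := by
    obtain ⟨C, hC⟩ := hG.bdd
    obtain ⟨D, hD⟩ := hH.bdd
    exact ⟨C + D, fun ξ => (abs_add_le _ _).trans (add_le_add (hC ξ) (hD ξ))⟩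
  nonneg b hb x := by
    obtain ⟨C, hC⟩ := hG.bdd
    obtain ⟨D, hD⟩ := hH.bdd
    simp only [mul_add]
    rw [integral_add (integrable_cos_mul_exp_mul hG.meas hC hb x)
      (integrable_cos_mul_exp_mul hH.meas hD hb x)]
    exact add_nonneg (hG.nonneg b hb x) (hH.nonneg b hb x)

theorem GaussPos.const_mul {G : E N → ℝ} (hG : GaussPos G) {c : ℝ} (hc : 0 ≤ c) :
    GaussPos (fun ξ => c * G ξ) where
  meas := hG.meas.const_mul c
  bdd := by
    obtain ⟨C, hC⟩ := hG.bdd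
    exact ⟨c * C, fun ξ => by
      rw [abs_mul, abs_of_nonneg hc]; exact mul_le_mul_of_nonneg_left (hC ξ) hc⟩
  nonneg b hb x := by
    simp only [mul_left_comm _ c]
    rw [integral_const_mul]
    exact mul_nonneg hc (hG.nonneg b hb x)

/-- A mixture of centred Gaussians. -/
def gaussMix (a : ℝ) (ρ : ℝ → ℝ) (ξ : E N) : ℝ :=
  ∫ μ in Ioi a, Real.exp (-μ * ‖ξ‖ ^ 2) * ρ μ

theorem measurable_gaussMix (a : ℝ) {ρ : ℝ → ℝ} (hρ : Measurable ρ) :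
    Measurable (gaussMix (N := N) a ρ) := by
  have : StronglyMeasurable fun q : E N × ℝ => Real.exp (-q.2 * ‖q.1‖ ^ 2) * ρ q.2 :=
    Measurable.stronglyMeasurable (by fun_prop)
  exact this.integral_prod_right.measurable

theorem gaussMix_nonneg {a : ℝ} {ρ : ℝ → ℝ} (hρ0 : ∀ μ ∈ Ioi a, 0 ≤ ρ μ) (ξ : E N) :
    0 ≤ gaussMix a ρ ξ :=
  setIntegral_nonneg measurableSet_Ioi fun μ hμ => mul_nonneg (Real.exp_pos _).le (hρ0 μ hμ)

theorem gaussMix_le {a : ℝ} (ha : 0 ≤ a) {ρ : ℝ → ℝ} (hρ0 : ∀ μ ∈ Ioi a, 0 ≤ ρ μ)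
    (hρ : IntegrableOn ρ (Ioi a)) (ξ : E N) : gaussMix a ρ ξ ≤ ∫ μ in Ioi a, ρ μ := by
  refine integral_mono_of_nonneg ?_ hρ ?_
  · filter_upwards [ae_restrict_mem measurableSet_Ioi] with μ hμ
    exact mul_nonneg (Real.exp_pos _).le (hρ0 μ hμ)
  · filter_upwards [ae_restrict_mem measurableSet_Ioi] with μ hμ
    refine mul_le_of_le_one_left (hρ0 μ hμ) (Real.exp_le_one_iff.2 ?_)
    have : 0 ≤ μ := ha.trans (le_of_lt hμ)
    nlinarith [sq_nonneg ‖ξ‖, mul_nonneg this (sq_nonneg ‖ξ‖)]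

/-- A Gaussian of parameter `μ` is absorbed into the test Gaussian, replacing `b` by `b + μ`; Fubini
then integrates over `μ`. This is why `GaussPos` quantifies over all `b > 0`. -/
theorem GaussPos.gaussMix_mul {G : E N → ℝ} (hG : GaussPos G) {a : ℝ} (ha : 0 ≤ a) {ρ : ℝ → ℝ}
    (hρm : Measurable ρ) (hρ0 : ∀ μ ∈ Ioi a, 0 ≤ ρ μ) (hρ : IntegrableOn ρ (Ioi a)) :
    GaussPos (fun ξ => gaussMix a ρ ξ * G ξ) where
  meas := (measurable_gaussMix a hρm).mul hG.meas
  bdd := by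
    obtain ⟨C, hC⟩ := hG.bdd
    refine ⟨(∫ μ in Ioi a, ρ μ) * C, fun ξ => ?_⟩
    rw [abs_mul, abs_of_nonneg (gaussMix_nonneg hρ0 ξ)]
    exact mul_le_mul (gaussMix_le ha hρ0 hρ ξ) (hC ξ) (abs_nonneg _)
      (setIntegral_nonneg measurableSet_Ioi hρ0)
  nonneg b hb x := by
    obtain ⟨C, hC⟩ := hG.bdd
    have hint : Integrable (Function.uncurry fun (ξ : E N) (μ : ℝ) =>
        Real.cos (2 * π * ⟪ξ, x⟫) * Real.exp (-b * ‖ξ‖ ^ 2) *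
          (Real.exp (-μ * ‖ξ‖ ^ 2) * ρ μ * G ξ)) (volume.prod (volume.restrict (Ioi a))) := by
      refine (((integrable_exp_neg_mul_sq (N := N) hb).mul_prod hρ.norm).mul_const C).mono' ?_ ?_
      · have := hG.meas
        exact Measurable.aestronglyMeasurable (by unfold Function.uncurry; fun_prop)
      · have : ∀ᵐ q : E N × ℝ ∂(volume.prod (volume.restrict (Ioi a))), q.2 ∈ Ioi a :=
          Measure.quasiMeasurePreserving_snd.ae (ae_restrict_mem measurableSet_Ioi)
        filter_upwards [this] with q hq
        have h1 : Real.exp (-q.2 * ‖q.1‖ ^ 2) ≤ 1 := by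
          refine Real.exp_le_one_iff.2 ?_
          have : 0 ≤ q.2 := ha.trans (le_of_lt hq)
          nlinarith [sq_nonneg ‖q.1‖, mul_nonneg this (sq_nonneg ‖q.1‖)]
        have h2 : |Real.exp (-q.2 * ‖q.1‖ ^ 2) * ρ q.2 * G q.1| ≤ ‖ρ q.2‖ * C := by
          rw [abs_mul, abs_mul, abs_of_pos (Real.exp_pos _)]
          exact mul_le_mul (mul_le_of_le_one_left (abs_nonneg _) h1) (hC _) (abs_nonneg _)
            (abs_nonneg _)
        exact (abs_cos_mul_exp_mul_le _ _ _ _ h2).trans_eq (by ring)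
    have h1 : ∀ ξ : E N, Real.cos (2 * π * ⟪ξ, x⟫) * Real.exp (-b * ‖ξ‖ ^ 2) *
        (gaussMix a ρ ξ * G ξ) = ∫ μ in Ioi a, Real.cos (2 * π * ⟪ξ, x⟫) *
          Real.exp (-b * ‖ξ‖ ^ 2) * (Real.exp (-μ * ‖ξ‖ ^ 2) * ρ μ * G ξ) := by
      intro ξ
      rw [integral_const_mul, integral_mul_const]; rfl
    simp_rw [h1]
    rw [integral_integral_swap hint]
    refine setIntegral_nonneg measurableSet_Ioi fun μ hμ => ?_
    have h2 : ∀ ξ : E N, Real.cos (2 * π * ⟪ξ, x⟫) * Real.exp (-b * ‖ξ‖ ^ 2) *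
        (Real.exp (-μ * ‖ξ‖ ^ 2) * ρ μ * G ξ) = ρ μ * (Real.cos (2 * π * ⟪ξ, x⟫) *
          Real.exp (-(b + μ) * ‖ξ‖ ^ 2) * G ξ) := by
      intro ξ
      rw [show -(b + μ) * ‖ξ‖ ^ 2 = -b * ‖ξ‖ ^ 2 + -μ * ‖ξ‖ ^ 2 by ring, Real.exp_add]; ring
    simp_rw [h2]
    rw [integral_const_mul]
    exact mul_nonneg (hρ0 μ hμ)
      (hG.nonneg _ (add_pos_of_pos_of_nonneg hb (ha.trans (le_of_lt hμ))) x)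

/-- The exponential series has nonnegative coefficients, and powers of a mixture stay in the class
by repeated multiplication. -/
theorem GaussPos.exp_gaussMix {a : ℝ} (ha : 0 ≤ a) {ρ : ℝ → ℝ}
    (hρm : Measurable ρ) (hρ0 : ∀ μ ∈ Ioi a, 0 ≤ ρ μ) (hρ : IntegrableOn ρ (Ioi a)) :
    GaussPos (fun ξ : E N => Real.exp (gaussMix a ρ ξ)) := by
  have hpow : ∀ k : ℕ, GaussPos (fun ξ : E N => gaussMix a ρ ξ ^ k) := by
    intro k
    induction k with
    | zero => simpa using GaussPos.one
    | succ k ih => simpa only [pow_succ'] using ih.gaussMix_mul ha hρm hρ0 hρ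
  have hsum : ∀ n : ℕ, GaussPos (fun ξ : E N =>
      ∑ k ∈ Finset.range n, gaussMix a ρ ξ ^ k / (k.factorial : ℝ)) := by
    intro n
    induction n with
    | zero => simpa using GaussPos.one.const_mul (N := N) (le_refl (0 : ℝ))
    | succ n ih =>
      simp only [Finset.sum_range_succ]
      refine ih.add ?_
      simpa only [div_eq_inv_mul] using (hpow n).const_mul (by positivity)
  refine GaussPos.of_tendsto hsum (C := Real.exp (∫ μ in Ioi a, ρ μ)) (fun n ξ => ?_) fun ξ => ?_
  · rw [abs_of_nonneg (Finset.sum_nonneg fun k _ =>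
      div_nonneg (pow_nonneg (gaussMix_nonneg hρ0 ξ) _) (by positivity))]
    exact (Real.sum_le_exp_of_nonneg (gaussMix_nonneg hρ0 ξ) n).trans
      (Real.exp_le_exp.2 (gaussMix_le ha hρ0 hρ ξ))
  · rw [Real.exp_eq_exp_ℝ]
    exact (NormedSpace.expSeries_div_hasSum_exp (gaussMix a ρ ξ)).tendsto_sum_nat

/-! ### The subordination formula for `r ^ s` -/

/-- Near `0` the factor `1 - exp (-μ r) ≤ μ r` leaves `μ ^ (-s)`, integrable since `s < 1`; at
infinity `μ ^ (-1 - s)` is integrable since `s > 0`. -/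
theorem integrableOn_one_sub_exp_mul_rpow {s : ℝ} (hs0 : 0 < s) (hs1 : s < 1) {r : ℝ}
    (hr : 0 ≤ r) :
    IntegrableOn (fun μ : ℝ => (1 - Real.exp (-μ * r)) * μ ^ (-1 - s)) (Ioi 0) := by
  rw [← Ioc_union_Ioi_eq_Ioi (zero_le_one' ℝ)]
  have hm : Measurable fun μ : ℝ => (1 - Real.exp (-μ * r)) * μ ^ (-1 - s) := by fun_prop
  refine IntegrableOn.union ?_ ?_
  · have h1 : IntegrableOn (fun μ : ℝ => r * μ ^ (-s)) (Ioc 0 1) := by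
      refine Integrable.const_mul ?_ r
      exact (intervalIntegrable_iff_integrableOn_Ioc_of_le zero_le_one).1
        (intervalIntegral.intervalIntegrable_rpow' (by linarith))
    refine h1.mono' hm.aestronglyMeasurable ?_
    filter_upwards [ae_restrict_mem measurableSet_Ioc] with μ hμ
    have h2 : 1 - Real.exp (-μ * r) ≤ μ * r := by
      have := Real.add_one_le_exp (-μ * r); linarith
    have h3 : Real.exp (-μ * r) ≤ 1 := Real.exp_le_one_iff.2 (by nlinarith [hμ.1])
    have h4 : 0 ≤ μ ^ (-1 - s) := Real.rpow_nonneg hμ.1.le _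
    rw [Real.norm_eq_abs, abs_of_nonneg (mul_nonneg (by linarith) h4)]
    calc (1 - Real.exp (-μ * r)) * μ ^ (-1 - s) ≤ μ * r * μ ^ (-1 - s) := by gcongr
      _ = r * (μ ^ (1 : ℝ) * μ ^ (-1 - s)) := by rw [Real.rpow_one]; ring
      _ = r * μ ^ (-s) := by rw [← Real.rpow_add hμ.1]; ring_nf
  · have h1 : IntegrableOn (fun μ : ℝ => μ ^ (-1 - s)) (Ioi 1) :=
      integrableOn_Ioi_rpow_of_lt (by linarith) zero_lt_one
    refine h1.mono' hm.aestronglyMeasurable ?_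
    filter_upwards [ae_restrict_mem measurableSet_Ioi] with μ hμ
    have hμ0 : 0 < μ := zero_lt_one.trans hμ
    have h3 : Real.exp (-μ * r) ≤ 1 := Real.exp_le_one_iff.2 (by nlinarith)
    have h4 : 0 ≤ μ ^ (-1 - s) := Real.rpow_nonneg hμ0.le _
    rw [Real.norm_eq_abs, abs_of_nonneg (mul_nonneg (by linarith) h4)]
    exact mul_le_of_le_one_left h4 (by linarith [Real.exp_pos (-μ * r)])

/-- The normalising constant of the subordination formula for `r ^ s`. -/
def subordConst (s : ℝ) : ℝ := ∫ μ in Ioi (0 : ℝ), (1 - Real.exp (-μ * 1)) * μ ^ (-1 - s)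

theorem subordConst_pos {s : ℝ} (hs0 : 0 < s) (hs1 : s < 1) : 0 < subordConst s := by
  have hpos : ∀ μ ∈ Ioi (0 : ℝ), 0 < (1 - Real.exp (-μ * 1)) * μ ^ (-1 - s) := fun μ hμ =>
    mul_pos (by rw [sub_pos, Real.exp_lt_one_iff]; linarith [mem_Ioi.1 hμ])
      (Real.rpow_pos_of_pos hμ _)
  rw [subordConst, setIntegral_pos_iff_support_of_nonneg_ae
    ((ae_restrict_mem measurableSet_Ioi).mono fun μ hμ => (hpos μ hμ).le)
    (integrableOn_one_sub_exp_mul_rpow hs0 hs1 zero_le_one)]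
  have hsub : Ioi (0 : ℝ) ⊆ Function.support fun μ : ℝ => (1 - Real.exp (-μ * 1)) * μ ^ (-1 - s) :=
    fun μ hμ => (hpos μ hμ).ne'
  rw [inter_eq_self_of_subset_right hsub]
  simp

/-- Scaling: the substitution `μ ↦ r μ` reduces to `r = 1`. -/
theorem integral_one_sub_exp_mul_rpow {s : ℝ} (hs0 : 0 < s) {r : ℝ} (hr : 0 ≤ r) :
    ∫ μ in Ioi (0 : ℝ), (1 - Real.exp (-μ * r)) * μ ^ (-1 - s) = subordConst s * r ^ s := by
  rcases hr.eq_or_lt with rfl | hr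
  · simp [Real.zero_rpow hs0.ne']
  have h := integral_comp_mul_left_Ioi (fun μ : ℝ => (1 - Real.exp (-μ * 1)) * μ ^ (-1 - s)) 0 hr
  rw [mul_zero, smul_eq_mul] at h
  have h2 : ∫ μ in Ioi (0 : ℝ), (1 - Real.exp (-(r * μ) * 1)) * (r * μ) ^ (-1 - s) =
      ∫ μ in Ioi (0 : ℝ), r ^ (-1 - s) * ((1 - Real.exp (-μ * r)) * μ ^ (-1 - s)) := by
    refine setIntegral_congr_fun measurableSet_Ioi fun μ hμ => ?_
    rw [Real.mul_rpow hr.le (le_of_lt hμ)]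
    ring_nf
  rw [h2, integral_const_mul] at h
  change _ = r⁻¹ * subordConst s at h
  have h3 : r ^ s * r * r ^ (-1 - s) = 1 := by
    nth_rewrite 2 [← Real.rpow_one r]
    rw [← Real.rpow_add hr, ← Real.rpow_add hr]; ring_nf; simp
  calc _ = r ^ s * r * (r ^ (-1 - s) *
        ∫ μ in Ioi (0 : ℝ), (1 - Real.exp (-μ * r)) * μ ^ (-1 - s)) := by
        rw [← mul_assoc, h3, one_mul]
    _ = _ := by rw [h]; field_simp

/-- The density `μ ^ (-1 - s)` has infinite mass at `0`, so the subordination integral is cut off at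
`μ > 1/(n+1)`. There the `1` and the `exp (-μ r)` separate, giving a positive constant times `exp`
of a Gaussian mixture, and the cut-off is then removed. -/
theorem GaussPos.exp_neg_mul_norm_rpow {s : ℝ} (hs0 : 0 < s) (hs1 : s < 1) {τ : ℝ} (hτ : 0 ≤ τ) :
    GaussPos (fun ξ : E N => Real.exp (-τ * (‖ξ‖ ^ 2) ^ s)) := by
  set c := τ / subordConst s with hc
  have hc0 : 0 ≤ c := div_nonneg hτ (subordConst_pos hs0 hs1).le
  set a : ℕ → ℝ := fun n => 1 / ((n : ℝ) + 1) with ha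
  have ha0 : ∀ n, 0 < a n := fun n => Nat.one_div_pos_of_nat
  set ρ : ℝ → ℝ := fun μ => c * μ ^ (-1 - s) with hρ
  have hρm : Measurable ρ := by fun_prop
  have hρ0 : ∀ n, ∀ μ ∈ Ioi (a n), 0 ≤ ρ μ := fun n μ hμ =>
    mul_nonneg hc0 (Real.rpow_nonneg ((ha0 n).le.trans (le_of_lt hμ)) _)
  have hρi : ∀ n, IntegrableOn ρ (Ioi (a n)) := fun n =>
    (integrableOn_Ioi_rpow_of_lt (by linarith) (ha0 n)).const_mul c
  have hI : ∀ (n : ℕ) (ξ : E N), Real.exp (-∫ μ in Ioi (a n), ρ μ) * Real.exp (gaussMix (a n) ρ ξ) =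
      Real.exp (-(c * ∫ μ in Ioi (a n), (1 - Real.exp (-μ * ‖ξ‖ ^ 2)) * μ ^ (-1 - s))) := by
    intro n ξ
    rw [← Real.exp_add, ← integral_const_mul]
    congr 1
    have hi : IntegrableOn (fun μ => Real.exp (-μ * ‖ξ‖ ^ 2) * ρ μ) (Ioi (a n)) := by
      refine (hρi n).mono' (by fun_prop) ?_
      filter_upwards [ae_restrict_mem measurableSet_Ioi] with μ hμ
      rw [Real.norm_eq_abs, abs_of_nonneg (mul_nonneg (Real.exp_pos _).le (hρ0 n μ hμ))]
      refine mul_le_of_le_one_left (hρ0 n μ hμ) (Real.exp_le_one_iff.2 ?_)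
      have : 0 ≤ μ := (ha0 n).le.trans (le_of_lt hμ)
      nlinarith [mul_nonneg this (sq_nonneg ‖ξ‖)]
    rw [gaussMix, ← neg_eq_iff_eq_neg, neg_add, neg_neg, ← sub_eq_add_neg,
      ← integral_sub (hρi n) hi]
    refine integral_congr_ae (ae_of_all _ fun μ => ?_)
    simp only [hρ]; ring
  have hn0 : ∀ (n : ℕ) (ξ : E N),
      0 ≤ c * ∫ μ in Ioi (a n), (1 - Real.exp (-μ * ‖ξ‖ ^ 2)) * μ ^ (-1 - s) := by
    intro n ξ
    refine mul_nonneg hc0 (setIntegral_nonneg measurableSet_Ioi fun μ hμ => ?_)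
    have h0 : 0 ≤ μ := (ha0 n).le.trans (le_of_lt hμ)
    refine mul_nonneg ?_ (Real.rpow_nonneg h0 _)
    rw [sub_nonneg, Real.exp_le_one_iff]
    nlinarith [mul_nonneg h0 (sq_nonneg ‖ξ‖)]
  refine GaussPos.of_tendsto (C := 1)
    (G := fun n ξ => Real.exp (-∫ μ in Ioi (a n), ρ μ) * Real.exp (gaussMix (a n) ρ ξ))
    (fun n => (GaussPos.exp_gaussMix (ha0 n).le hρm (hρ0 n) (hρi n)).const_mul
      (Real.exp_pos _).le) (fun n ξ => ?_) fun ξ => ?_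
  · rw [hI, abs_of_pos (Real.exp_pos _), Real.exp_le_one_iff]
    linarith [hn0 n ξ]
  · simp_rw [hI]
    have h1 : -τ * (‖ξ‖ ^ 2) ^ s = -(c * (subordConst s * (‖ξ‖ ^ 2) ^ s)) := by
      rw [hc]; field_simp [(subordConst_pos hs0 hs1).ne']
    rw [h1, ← integral_one_sub_exp_mul_rpow hs0 (sq_nonneg ‖ξ‖)]
    refine (Real.continuous_exp.tendsto _).comp (Tendsto.neg (Tendsto.const_mul c ?_))
    have hcov : AECover (volume.restrict (Ioi (0 : ℝ))) atTop fun n => Ioi (a n) :=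
      aecover_Ioi_of_Ioi tendsto_one_div_add_atTop_nhds_zero_nat
    have := hcov.integral_tendsto_of_countably_generated
      (integrableOn_one_sub_exp_mul_rpow hs0 hs1 (sq_nonneg ‖ξ‖))
    refine this.congr fun n => ?_
    rw [Measure.restrict_restrict measurableSet_Ioi,
      inter_eq_self_of_subset_left (Ioi_subset_Ioi (ha0 n).le)]

/-! ### Symbols and the mixed heat kernel -/

theorem fourierInv_ofReal_of_even {F : E N → ℝ} (hF : Integrable F) (heven : ∀ ξ, F (-ξ) = F ξ)
    (x : E N) :
    𝓕⁻ (fun ξ => (F ξ : ℂ)) x = ((∫ ξ, Real.cos (2 * π * ⟪ξ, x⟫) * F ξ : ℝ) : ℂ) := by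
  have hi : Integrable fun ξ : E N =>
      Complex.exp (((2 * π * ⟪ξ, x⟫ : ℝ) : ℂ) * Complex.I) • (F ξ : ℂ) := by
    have hc : Continuous fun ξ : E N =>
        Complex.exp (((2 * π * ⟪ξ, x⟫ : ℝ) : ℂ) * Complex.I) := by fun_prop
    refine (hF.ofReal (𝕜 := ℂ)).norm.mono' (hc.aestronglyMeasurable.smul
      (hF.ofReal (𝕜 := ℂ)).aestronglyMeasurable) (ae_of_all _ fun ξ => ?_)
    rw [norm_smul, Complex.norm_exp_ofReal_mul_I, one_mul]
    exact le_rfl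
  rw [Real.fourierInv_eq']
  apply Complex.ext
  · rw [← Complex.reCLM_apply, ← Complex.reCLM.integral_comp_comm hi, Complex.ofReal_re]
    exact integral_congr_ae (ae_of_all _ fun ξ => re_exp_mul_I_smul _ _)
  · rw [← Complex.imCLM_apply, ← Complex.imCLM.integral_comp_comm hi, Complex.ofReal_im]
    have h1 : ∀ ξ : E N, Complex.imCLM (Complex.exp (((2 * π * ⟪ξ, x⟫ : ℝ) : ℂ) * Complex.I) •
        (F ξ : ℂ)) = Real.sin (2 * π * ⟪ξ, x⟫) * F ξ := fun ξ => im_exp_mul_I_smul _ _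
    simp_rw [h1]
    have h2 := integral_neg_eq_self (fun ξ : E N => Real.sin (2 * π * ⟪ξ, x⟫) * F ξ) volume
    simp only [inner_neg_left, mul_neg, Real.sin_neg, heven, neg_mul, integral_neg] at h2
    linarith

theorem integral_fourier_mul_eq {f g : E N → ℂ} (hf : Integrable f) (hg : Integrable g) :
    ∫ ξ, 𝓕 f ξ * g ξ = ∫ ξ, f ξ * 𝓕 g ξ := by
  have := VectorFourier.integral_fourierIntegral_smul_eq_flip (L := innerₗ (E N))
    Real.continuous_fourierChar continuous_inner hf hg
  rw [flip_innerₗ] at this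
  exact this

theorem integral_fourierInv_mul_eq {f g : E N → ℂ} (hf : Integrable f) (hg : Integrable g) :
    ∫ ξ, 𝓕⁻ f ξ * g ξ = ∫ ξ, f ξ * 𝓕⁻ g ξ := by
  have h := integral_fourier_mul_eq hf.comp_neg hg
  have h1 : 𝓕⁻ f = 𝓕 fun x => f (-x) := Real.fourierInv_eq_fourier_comp_neg f
  rw [h1]
  refine h.trans ?_
  rw [← integral_neg_eq_self]
  simp [Real.fourierInv_eq_fourier_neg]

/-- The symbol of the fractional heat semigroup. -/
def fracSymbol (s t : ℝ) (ξ : E N) : ℝ := Real.exp (-t * (2 * π * ‖ξ‖) ^ (2 * s))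

/-- The symbol of the mixed heat semigroup. -/
def heatSymbol (s t : ℝ) (ξ : E N) : ℝ :=
  Real.exp (-(4 * π ^ 2 * t) * ‖ξ‖ ^ 2) * fracSymbol s t ξ

theorem fracSymbol_pos (s t : ℝ) (ξ : E N) : 0 < fracSymbol s t ξ := Real.exp_pos _

theorem fracSymbol_le_one {t : ℝ} (s : ℝ) (ht : 0 ≤ t) (ξ : E N) : fracSymbol s t ξ ≤ 1 := by
  refine Real.exp_le_one_iff.2 ?_
  have : 0 ≤ (2 * π * ‖ξ‖) ^ (2 * s) := Real.rpow_nonneg (by positivity) _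
  nlinarith

theorem continuous_fracSymbol {s : ℝ} (hs : 0 < s) (t : ℝ) :
    Continuous (fracSymbol (N := N) s t) := by
  unfold fracSymbol
  refine Real.continuous_exp.comp (continuous_const.mul ?_)
  exact Continuous.rpow_const (by fun_prop) fun _ => Or.inr (by positivity)

theorem integrable_fracSymbol {s : ℝ} (hs : 0 < s) {t : ℝ} (ht : 0 < t) :
    Integrable (fracSymbol (N := N) s t) := by
  -- Dimension zero is not excluded here, and integration in polar coordinates needs a nontrivial
  -- space.
  rcases subsingleton_or_nontrivial (E N) with h | h
  · exact (continuous_fracSymbol hs t).integrable_of_hasCompactSupport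
      (HasCompactSupport.of_compactSpace _)
  have hb : 0 < t * (2 * π) ^ (2 * s) := by positivity
  have h1 := (integrable_fun_norm_addHaar (E := E N) volume
    (f := fun r : ℝ => Real.exp (-(t * (2 * π) ^ (2 * s)) * r ^ (2 * s)))).2 (by
      have := integrableOn_rpow_mul_exp_neg_mul_rpow (p := 2 * s)
        (s := ((Module.finrank ℝ (E N) - 1 : ℕ) : ℝ)) (by
          have : (0 : ℝ) ≤ ((Module.finrank ℝ (E N) - 1 : ℕ) : ℝ) := by positivity
          linarith) (by positivity) hb
      simpa only [Real.rpow_natCast, smul_eq_mul] using this)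
  refine h1.congr (ae_of_all _ fun ξ => ?_)
  simp only [fracSymbol]
  rw [Real.mul_rpow (by positivity) (norm_nonneg _)]
  ring_nf

theorem heatSymbol_pos (s t : ℝ) (ξ : E N) : 0 < heatSymbol s t ξ :=
  mul_pos (Real.exp_pos _) (fracSymbol_pos _ _ _)

theorem continuous_heatSymbol {s : ℝ} (hs : 0 < s) (t : ℝ) :
    Continuous (heatSymbol (N := N) s t) := by
  have := continuous_fracSymbol (N := N) hs t
  unfold heatSymbol
  fun_prop

theorem integrable_heatSymbol {s : ℝ} (hs : 0 < s) {t : ℝ} (ht : 0 < t) :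
    Integrable (heatSymbol (N := N) s t) := by
  refine (integrable_exp_neg_mul_sq (N := N) (b := 4 * π ^ 2 * t) (by positivity)).mono'
    (continuous_heatSymbol hs t).aestronglyMeasurable (ae_of_all _ fun ξ => ?_)
  rw [Real.norm_eq_abs, abs_of_pos (heatSymbol_pos _ _ _)]
  exact mul_le_of_le_one_right (Real.exp_pos _).le (fracSymbol_le_one s ht.le ξ)

theorem heatSymbol_neg (s t : ℝ) (ξ : E N) : heatSymbol s t (-ξ) = heatSymbol s t ξ := by
  simp [heatSymbol, fracSymbol]

theorem heatSymbol_add (s t r : ℝ) (ξ : E N) :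
    heatSymbol s (t + r) ξ = heatSymbol s t ξ * heatSymbol s r ξ := by
  simp only [heatSymbol, fracSymbol, ← Real.exp_add]
  ring_nf

theorem heatSymbol_zero {s : ℝ} (hs : 0 < s) (t : ℝ) : heatSymbol s t (0 : E N) = 1 := by
  simp [heatSymbol, fracSymbol, Real.zero_rpow (show 2 * s ≠ 0 by positivity)]

theorem fracHeatKernel_eq {s : ℝ} (hs : 0 < s) {t : ℝ} (ht : 0 < t) (x : E N) :
    (fracHeatKernel s t x : ℂ) = 𝓕⁻ (fun ξ : E N => (fracSymbol s t ξ : ℂ)) x := by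
  change (((𝓕⁻ (fun ξ : E N => (fracSymbol s t ξ : ℂ)) x).re : ℝ) : ℂ) = _
  rw [fourierInv_ofReal_of_even (integrable_fracSymbol hs ht)
    (fun ξ => by simp [fracSymbol]) x, Complex.ofReal_re]

/-- The Gaussian centred at `z` is the transform of a modulated Gaussian `G`. Moving the inverse
transform from the fractional symbol onto `𝓕 G` restores `G`, so integrability of the fractional
kernel is never required. -/
theorem mixedHeatKernel_eq_fourierInv {s : ℝ} (hs : 0 < s) {t : ℝ} (ht : 0 < t) (z : E N) :
    (mixedHeatKernel s t z : ℂ) = 𝓕⁻ (fun ξ : E N => (heatSymbol s t ξ : ℂ)) z := by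
  set b : ℝ := 4 * π ^ 2 * t with hb
  have hb0 : 0 < b := by positivity
  set G : E N → ℂ := fun v =>
    Complex.exp (-(b : ℂ) * ‖v‖ ^ 2 + 2 * π * Complex.I * ⟪z, v⟫) with hG
  have hGi : Integrable G :=
    GaussianFourier.integrable_cexp_neg_mul_sq_norm_add (by simpa using hb0) _ z
  have hGc : Continuous G := by fun_prop
  have hFG : ∀ w : E N, 𝓕 G w = ((1 / (4 * π * t) ^ ((N : ℝ) / 2) *
      Real.exp (-(‖z - w‖ ^ 2 / (4 * t))) : ℝ) : ℂ) := by
    intro w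
    rw [hG, fourier_gaussian_innerProductSpace' (by simpa using hb0) z w]
    have h1 : (1 : ℝ) / (4 * π * t) ^ ((N : ℝ) / 2) = (π / b) ^ ((N : ℝ) / 2) := by
      rw [show π / b = 1 / (4 * π * t) by rw [hb]; field_simp,
        Real.div_rpow zero_le_one (by positivity), Real.one_rpow]
    have h2 : -(‖z - w‖ ^ 2 / (4 * t)) = -π ^ 2 * ‖z - w‖ ^ 2 / b := by
      rw [hb]; field_simp
    rw [h1, h2, finrank_euclideanSpace_fin]
    push_cast [Complex.ofReal_cpow (div_nonneg pi_pos.le hb0.le)]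
    rfl
  have hFGi : Integrable (𝓕 G) := by
    have h1 := ((integrable_exp_neg_mul_sq (N := N) (b := 1 / (4 * t))
      (by positivity)).comp_sub_left z).const_mul (1 / (4 * π * t) ^ ((N : ℝ) / 2))
    refine h1.ofReal.congr (ae_of_all _ fun w => ?_)
    rw [hFG]
    simp only
    rw [show -(1 / (4 * t)) * ‖z - w‖ ^ 2 = -(‖z - w‖ ^ 2 / (4 * t)) by ring]
    rfl
  have key := integral_fourierInv_mul_eq (integrable_fracSymbol (N := N) hs ht).ofReal hFGi
  rw [hGc.fourierInv_fourier_eq hGi hFGi] at key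
  have hleft : (mixedHeatKernel s t z : ℂ) =
      ∫ ξ, 𝓕⁻ (fun ξ : E N => (fracSymbol s t ξ : ℂ)) ξ * 𝓕 G ξ := by
    rw [mixedHeatKernel, ← integral_const_mul, ← integral_complex_ofReal]
    refine integral_congr_ae (ae_of_all _ fun ξ => ?_)
    simp only [hFG, ← fracHeatKernel_eq hs ht]
    push_cast; ring
  rw [hleft]
  refine key.trans ?_
  rw [Real.fourierInv_eq']
  refine integral_congr_ae (ae_of_all _ fun ξ => ?_)
  simp only [hG, smul_eq_mul, heatSymbol, Complex.coe_algebraMap]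
  push_cast
  rw [Complex.exp_add, real_inner_comm, hb]
  push_cast
  ring_nf

theorem mixedHeatKernel_eq_integral_cos {s : ℝ} (hs : 0 < s) {t : ℝ} (ht : 0 < t) (z : E N) :
    mixedHeatKernel s t z = ∫ ξ, Real.cos (2 * π * ⟪ξ, z⟫) * heatSymbol s t ξ := by
  have h := mixedHeatKernel_eq_fourierInv hs ht z
  rw [fourierInv_ofReal_of_even (integrable_heatSymbol hs ht) (heatSymbol_neg s t)] at h
  exact_mod_cast h

/-- The Gaussian factor of the mixed symbol plays the role of the test Gaussian in `GaussPos`, with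
`b = 4π²t`. -/
theorem mixedHeatKernel_nonneg {s : ℝ} (hs0 : 0 < s) (hs1 : s < 1) {t : ℝ} (ht : 0 < t)
    (z : E N) : 0 ≤ mixedHeatKernel s t z := by
  rw [mixedHeatKernel_eq_integral_cos hs0 ht]
  have h := (GaussPos.exp_neg_mul_norm_rpow (N := N) hs0 hs1 (τ := t * (2 * π) ^ (2 * s))
    (by positivity)).nonneg (4 * π ^ 2 * t) (by positivity) z
  refine h.trans_eq (integral_congr_ae (ae_of_all _ fun ξ => ?_))
  simp only [heatSymbol, fracSymbol]
  rw [Real.mul_rpow (by positivity) (norm_nonneg ξ), Real.rpow_mul (norm_nonneg ξ),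
    Real.rpow_two, mul_assoc]
  ring_nf

theorem mixedHeatKernel_le {s : ℝ} (hs : 0 < s) {t : ℝ} (ht : 0 < t) (z : E N) :
    |mixedHeatKernel s t z| ≤ ∫ ξ : E N, heatSymbol s t ξ := by
  rw [mixedHeatKernel_eq_integral_cos hs ht, ← Real.norm_eq_abs]
  refine norm_integral_le_of_norm_le (integrable_heatSymbol hs ht) (ae_of_all _ fun ξ => ?_)
  rw [Real.norm_eq_abs, abs_mul, abs_of_pos (heatSymbol_pos _ _ _)]
  exact mul_le_of_le_one_left (heatSymbol_pos _ _ _).le (Real.abs_cos_le_one _)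

theorem continuous_mixedHeatKernel {s : ℝ} (hs : 0 < s) {t : ℝ} (ht : 0 < t) :
    Continuous (mixedHeatKernel (N := N) s t) := by
  have h1 : mixedHeatKernel (N := N) s t =
      fun z => ∫ ξ, Real.cos (2 * π * ⟪ξ, z⟫) * heatSymbol s t ξ :=
    funext (mixedHeatKernel_eq_integral_cos hs ht)
  rw [h1]
  have h2 := continuous_heatSymbol (N := N) hs t
  refine continuous_of_dominated (bound := heatSymbol s t)
    (fun z => Continuous.aestronglyMeasurable (by fun_prop)) (fun z => ae_of_all _ fun ξ => ?_)
    (integrable_heatSymbol hs ht) (ae_of_all _ fun ξ => by fun_prop)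
  rw [Real.norm_eq_abs, abs_mul, abs_of_pos (heatSymbol_pos _ _ _)]
  exact mul_le_of_le_one_left (heatSymbol_pos _ _ _).le (Real.abs_cos_le_one _)

theorem measurable_fracHeatKernel (s : ℝ) :
    Measurable fun q : ℝ × E N => fracHeatKernel s q.1 q.2 := by
  have h1 : Measurable fun p : (ℝ × E N) × E N =>
      Complex.exp (((2 * π * ⟪p.2, p.1.2⟫ : ℝ) : ℂ) * Complex.I) •
        ((Real.exp (-p.1.1 * (2 * π * ‖p.2‖) ^ (2 * s)) : ℝ) : ℂ) := by
    have h2 : Measurable fun p : (ℝ × E N) × E N =>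
        Real.exp (-p.1.1 * (2 * π * ‖p.2‖) ^ (2 * s)) := by fun_prop
    have h3 : Measurable fun p : (ℝ × E N) × E N =>
        Complex.exp (((2 * π * ⟪p.2, p.1.2⟫ : ℝ) : ℂ) * Complex.I) := by fun_prop
    exact h3.smul (Complex.measurable_ofReal.comp h2)
  have h4 := h1.stronglyMeasurable.integral_prod_right' (ν := (volume : Measure (E N)))
  have h5 := Complex.measurable_re.comp h4.measurable
  simp only [fracHeatKernel, Real.fourierInv_eq']
  exact h5

theorem measurable_mixedHeatKernel (s : ℝ) :
    Measurable fun q : ℝ × E N => mixedHeatKernel s q.1 q.2 := by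
  have hg : Measurable fun p : (ℝ × E N) × E N => (p.1.1, p.2) := by fun_prop
  have h2 := (measurable_fracHeatKernel s).comp hg
  have h3 : Measurable fun p : (ℝ × E N) × E N =>
      Real.exp (-(‖p.1.2 - p.2‖ ^ 2 / (4 * p.1.1))) := by fun_prop
  have h4 := (h3.mul h2).stronglyMeasurable.integral_prod_right' (ν := (volume : Measure (E N)))
  have h5 : Measurable fun q : ℝ × E N => 1 / (4 * π * q.1) ^ ((N : ℝ) / 2) := by fun_prop
  have h6 := h5.mul h4.measurable
  simp only [mixedHeatKernel]
  exact h6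

/-- The mass is the symbol at `0`. Integrability of the kernel is not yet known, so it is damped by
slowly decaying Gaussians: by duality the damped integrals are an approximate identity acting on the
symbol at `0`, while positivity makes them increase to the full mass. -/
theorem lintegral_mixedHeatKernel {s : ℝ} (hs0 : 0 < s) (hs1 : s < 1) {t : ℝ} (ht : 0 < t) :
    ∫⁻ z : E N, ENNReal.ofReal (mixedHeatKernel s t z) = 1 := by
  set φ : ℕ → E N → ℝ := fun n z =>
    Real.exp (-((n : ℝ) + 1)⁻¹ * ‖z‖ ^ 2) * mixedHeatKernel s t z with hφ
  have hφc : ∀ n, Continuous (φ n) := fun n => by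
    have := continuous_mixedHeatKernel (N := N) hs0 ht
    fun_prop
  have hφ0 : ∀ n z, 0 ≤ φ n z := fun n z =>
    mul_nonneg (Real.exp_pos _).le (mixedHeatKernel_nonneg hs0 hs1 ht z)
  have hφi : ∀ n, Integrable (φ n) := fun n => by
    refine ((integrable_exp_neg_mul_sq (N := N) (b := ((n : ℝ) + 1)⁻¹) (by positivity)).mul_const
      (∫ ξ : E N, heatSymbol s t ξ)).mono' (hφc n).aestronglyMeasurable (ae_of_all _ fun z => ?_)
    rw [Real.norm_eq_abs, abs_mul, abs_of_pos (Real.exp_pos _)]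
    exact mul_le_mul_of_nonneg_left (mixedHeatKernel_le hs0 ht z) (Real.exp_pos _).le
  have hint : ∀ n : ℕ, ((∫ z, φ n z : ℝ) : ℂ) = ∫ w : E N,
      (((π : ℂ) * ((n : ℝ) + 1 : ℝ)) ^ (Module.finrank ℝ (E N) / 2 : ℂ) *
        Complex.exp (-(π : ℂ) ^ 2 * ((n : ℝ) + 1 : ℝ) * ‖(0 : E N) - w‖ ^ 2)) •
          (heatSymbol s t w : ℂ) := by
    intro n
    have hb : 0 < ((n : ℝ) + 1)⁻¹ := by positivity
    have hg : Integrable fun z : E N =>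
        Complex.exp (-((((n : ℝ) + 1)⁻¹ : ℝ) : ℂ) * (‖z‖ : ℂ) ^ 2) := by
      refine (integrable_exp_neg_mul_sq (N := N) hb).ofReal.congr (ae_of_all _ fun z => ?_)
      simp
    have h := integral_fourierInv_mul_eq (integrable_heatSymbol (N := N) hs0 ht).ofReal hg
    rw [← integral_complex_ofReal]
    have h1 : ∀ z : E N, ((φ n z : ℝ) : ℂ) = 𝓕⁻ (fun ξ : E N => (heatSymbol s t ξ : ℂ)) z *
        Complex.exp (-((((n : ℝ) + 1)⁻¹ : ℝ) : ℂ) * (‖z‖ : ℂ) ^ 2) := by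
      intro z
      rw [← mixedHeatKernel_eq_fourierInv hs0 ht, hφ]
      push_cast
      ring
    simp_rw [h1]
    refine h.trans (integral_congr_ae (ae_of_all _ fun w => ?_))
    simp only [Real.fourierInv_eq_fourier_neg]
    rw [fourier_gaussian_innerProductSpace (by rwa [Complex.ofReal_re]), zero_sub, smul_eq_mul]
    have h2 : (π : ℂ) / ((((n : ℝ) + 1)⁻¹ : ℝ) : ℂ) = (π : ℂ) * ((n : ℝ) + 1 : ℝ) := by
      push_cast; rw [div_inv_eq_mul]
    have h3 : -(π : ℂ) ^ 2 * (‖-w‖ : ℂ) ^ 2 / ((((n : ℝ) + 1)⁻¹ : ℝ) : ℂ) =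
        -(π : ℂ) ^ 2 * ((n : ℝ) + 1 : ℝ) * (‖-w‖ : ℂ) ^ 2 := by
      push_cast; rw [div_inv_eq_mul]; ring
    rw [h2, h3]
    exact mul_comm _ _
  have hlim : Tendsto (fun n => ∫ z, φ n z) atTop (𝓝 1) := by
    have h1 := (Real.tendsto_integral_gaussian_smul' (v := (0 : E N))
      (integrable_heatSymbol (N := N) hs0 ht).ofReal
      (Complex.continuous_ofReal.comp (continuous_heatSymbol hs0 t)).continuousAt).comp
      (tendsto_natCast_atTop_atTop.atTop_add (tendsto_const_nhds (x := (1 : ℝ))))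
    have h2 : Tendsto (fun n => ((∫ z, φ n z : ℝ) : ℂ)) atTop (𝓝 ((1 : ℝ) : ℂ)) := by
      refine (h1.congr fun n => (hint n).symm).trans_eq ?_
      simp [heatSymbol_zero hs0]
    exact (Complex.continuous_re.tendsto _).comp h2
  have hmono := lintegral_tendsto_of_tendsto_of_monotone (μ := volume)
    (f := fun n z => ENNReal.ofReal (φ n z))
    (F := fun z : E N => ENNReal.ofReal (mixedHeatKernel s t z))
    (fun n => (hφc n).measurable.ennreal_ofReal.aemeasurable)
    (ae_of_all _ fun z n m hnm => ENNReal.ofReal_le_ofReal (by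
      refine mul_le_mul_of_nonneg_right (Real.exp_le_exp.2 ?_)
        (mixedHeatKernel_nonneg hs0 hs1 ht z)
      have : ((m : ℝ) + 1)⁻¹ ≤ ((n : ℝ) + 1)⁻¹ := by gcongr
      nlinarith [sq_nonneg ‖z‖]))
    (ae_of_all _ fun z => ENNReal.tendsto_ofReal (by
      have h0 : Tendsto (fun n : ℕ => ((n : ℝ) + 1)⁻¹) atTop (𝓝 0) := by
        simpa using tendsto_one_div_add_atTop_nhds_zero_nat (𝕜 := ℝ)
      have h1 := ((Real.continuous_exp.tendsto _).comp
        (h0.neg.mul_const (‖z‖ ^ 2))).mul_const (mixedHeatKernel s t z)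
      simpa [hφ] using h1))
  refine tendsto_nhds_unique hmono ?_
  have := ENNReal.tendsto_ofReal hlim
  rw [ENNReal.ofReal_one] at this
  refine this.congr fun n => ?_
  exact ofReal_integral_eq_lintegral_ofReal (hφi n) (ae_of_all _ (hφ0 n))

theorem integrable_mixedHeatKernel {s : ℝ} (hs0 : 0 < s) (hs1 : s < 1) {t : ℝ} (ht : 0 < t) :
    Integrable (mixedHeatKernel (N := N) s t) := by
  refine ⟨(continuous_mixedHeatKernel hs0 ht).aestronglyMeasurable, ?_⟩
  rw [hasFiniteIntegral_iff_ofReal (ae_of_all _ (mixedHeatKernel_nonneg hs0 hs1 ht)),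
    lintegral_mixedHeatKernel hs0 hs1 ht]
  exact ENNReal.one_lt_top

theorem fourier_mixedHeatKernel {s : ℝ} (hs0 : 0 < s) (hs1 : s < 1) {t : ℝ} (ht : 0 < t)
    (ξ : E N) : 𝓕 (fun z : E N => (mixedHeatKernel s t z : ℂ)) ξ = heatSymbol s t ξ := by
  have h1 : (fun z : E N => (mixedHeatKernel s t z : ℂ)) =
      𝓕⁻ (fun ξ : E N => (heatSymbol s t ξ : ℂ)) :=
    funext (mixedHeatKernel_eq_fourierInv hs0 ht)
  have hi : Integrable (𝓕⁻ (fun ξ : E N => (heatSymbol s t ξ : ℂ))) :=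
    h1 ▸ (integrable_mixedHeatKernel hs0 hs1 ht).ofReal
  have hi2 : Integrable (𝓕 (fun ξ : E N => (heatSymbol s t ξ : ℂ))) := by
    refine hi.comp_neg.congr (ae_of_all _ fun z => ?_)
    simp only [Real.fourierInv_eq_fourier_neg, neg_neg]
  have hc : Continuous fun ξ : E N => (heatSymbol s t ξ : ℂ) :=
    Complex.continuous_ofReal.comp (continuous_heatSymbol hs0 t)
  rw [h1, hc.fourier_fourierInv_eq (integrable_heatSymbol hs0 ht).ofReal hi2]

/-- Chapman–Kolmogorov: on the Fourier side, convolution becomes the multiplicativity of the symbol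
in time. -/
theorem integral_mixedHeatKernel_mul {s : ℝ} (hs0 : 0 < s) (hs1 : s < 1) {t r : ℝ} (ht : 0 < t)
    (hr : 0 < r) (x : E N) :
    ∫ y, mixedHeatKernel s t (x - y) * mixedHeatKernel s r y = mixedHeatKernel s (t + r) x := by
  have hi := ((integrable_mixedHeatKernel (N := N) hs0 hs1 ht).comp_sub_left x).ofReal (𝕜 := ℂ)
  have h := integral_fourierInv_mul_eq (integrable_heatSymbol (N := N) hs0 hr).ofReal hi
  have hF : ∀ ξ : E N, 𝓕⁻ (fun y : E N => (mixedHeatKernel s t (x - y) : ℂ)) ξ =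
      Complex.exp (((2 * π * ⟪ξ, x⟫ : ℝ) : ℂ) * Complex.I) * heatSymbol s t ξ := by
    intro ξ
    rw [← fourier_mixedHeatKernel hs0 hs1 ht, Real.fourier_eq', Real.fourierInv_eq',
      ← integral_const_mul, ← integral_sub_left_eq_self _ volume x]
    refine integral_congr_ae (ae_of_all _ fun y => ?_)
    simp only [smul_eq_mul, sub_sub_cancel]
    rw [← mul_assoc, ← Complex.exp_add, inner_sub_left, real_inner_comm ξ x]
    congr 2
    push_cast
    ring
  have goal : (∫ y, (mixedHeatKernel s t (x - y) * mixedHeatKernel s r y : ℝ) : ℂ) =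
      mixedHeatKernel s (t + r) x := by
    rw [mixedHeatKernel_eq_fourierInv hs0 (add_pos ht hr), Real.fourierInv_eq']
    have h1 : ∀ y : E N, ((mixedHeatKernel s t (x - y) * mixedHeatKernel s r y : ℝ) : ℂ) =
        𝓕⁻ (fun ξ : E N => (heatSymbol s r ξ : ℂ)) y * (mixedHeatKernel s t (x - y) : ℂ) := by
      intro y
      rw [← mixedHeatKernel_eq_fourierInv hs0 hr]
      push_cast; ring
    simp_rw [h1]
    refine h.trans (integral_congr_ae (ae_of_all _ fun ξ => ?_))
    simp only [Complex.coe_algebraMap]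
    rw [hF, heatSymbol_add, smul_eq_mul]
    push_cast; ring
  rw [integral_complex_ofReal] at goal
  exact_mod_cast goal

/-! ### The semigroup on `[0, ∞]`-valued functions -/

/-- The heat semigroup acting on functions with values in `[0, ∞]`. -/
def heatOp (s t : ℝ) (g : E N → ℝ≥0∞) (x : E N) : ℝ≥0∞ :=
  ∫⁻ y, ENNReal.ofReal (mixedHeatKernel s t (x - y)) * g y

theorem heatOp_mono_ae (s t : ℝ) {g g' : E N → ℝ≥0∞} (h : ∀ᵐ y, g y ≤ g' y) (x : E N) :
    heatOp s t g x ≤ heatOp s t g' x :=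
  lintegral_mono_ae (h.mono fun _ hy => mul_le_mul_right hy _)

theorem heatOp_congr_ae (s t : ℝ) {g g' : E N → ℝ≥0∞} (h : g =ᵐ[volume] g') (x : E N) :
    heatOp s t g x = heatOp s t g' x :=
  lintegral_congr_ae (h.mono fun y hy => by simp only [hy])

theorem measurable_heatKernel_sub (s : ℝ) {Ω : Type*} [MeasurableSpace Ω] {τ : Ω → ℝ}
    (hτ : Measurable τ) : Measurable fun q : (Ω × E N) × E N =>
      ENNReal.ofReal (mixedHeatKernel s (τ q.1.1) (q.1.2 - q.2)) := by
  have h1 : Measurable fun q : (Ω × E N) × E N => (τ q.1.1, q.1.2 - q.2) := by fun_prop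
  exact ((measurable_mixedHeatKernel s).comp h1).ennreal_ofReal

theorem measurable_heatOp_param (s : ℝ) {Ω : Type*} [MeasurableSpace Ω] {τ : Ω → ℝ}
    (hτ : Measurable τ) {G : Ω → E N → ℝ≥0∞} (hG : Measurable fun q : Ω × E N => G q.1 q.2) :
    Measurable fun q : Ω × E N => heatOp s (τ q.1) (G q.1) q.2 := by
  have h2 : Measurable fun q : (Ω × E N) × E N => (q.1.1, q.2) := by fun_prop
  have h3 := (measurable_heatKernel_sub (N := N) s hτ).mul (hG.comp h2)
  exact h3.lintegral_prod_right'

theorem measurable_kernel_sub (s t : ℝ) (x : E N) :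
    Measurable fun y : E N => ENNReal.ofReal (mixedHeatKernel s t (x - y)) := by
  have h1 : Measurable fun y : E N => (t, x - y) := by fun_prop
  have h2 := ((measurable_mixedHeatKernel s).comp h1).ennreal_ofReal
  simpa only [Function.comp_apply] using h2

theorem measurable_heatOp (s t : ℝ) {g : E N → ℝ≥0∞} (hg : AEMeasurable g) :
    Measurable (heatOp s t g) := by
  have h1 : heatOp s t g = heatOp s t (hg.mk g) := funext (heatOp_congr_ae s t hg.ae_eq_mk)
  have h2 := (measurable_heatKernel_sub (N := N) s (Ω := Unit) (τ := fun _ => t)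
    measurable_const).mul (hg.measurable_mk.comp measurable_snd)
  have h3 : Measurable fun x : E N => ((), x) := by fun_prop
  have h4 := (h2.lintegral_prod_right' (ν := volume)).comp h3
  rw [h1]
  simp only [Function.comp_def, Pi.mul_apply] at h4
  exact h4

theorem heatOp_const {s : ℝ} (hs0 : 0 < s) (hs1 : s < 1) {t : ℝ} (ht : 0 < t) (c : ℝ≥0∞)
    (x : E N) : heatOp s t (fun _ => c) x = c := by
  rw [heatOp, lintegral_mul_const _ (measurable_kernel_sub s t x),
    lintegral_sub_left_eq_self (fun z => ENNReal.ofReal (mixedHeatKernel s t z)) x,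
    lintegral_mixedHeatKernel hs0 hs1 ht, one_mul]

theorem heatOp_le_of_ae_le {s : ℝ} (hs0 : 0 < s) (hs1 : s < 1) {t : ℝ} (ht : 0 < t) {c : ℝ≥0∞}
    {g : E N → ℝ≥0∞} (h : ∀ᵐ y, g y ≤ c) (x : E N) : heatOp s t g x ≤ c :=
  (heatOp_mono_ae s t h x).trans_eq (heatOp_const hs0 hs1 ht c x)

theorem heatOp_const_mul (s t : ℝ) {c : ℝ≥0∞} (hc : c ≠ ∞) (g : E N → ℝ≥0∞) (x : E N) :
    heatOp s t (fun y => c * g y) x = c * heatOp s t g x := by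
  simp only [heatOp, mul_left_comm _ c]
  exact lintegral_const_mul' _ _ hc

theorem heatOp_add_const {s : ℝ} (hs0 : 0 < s) (hs1 : s < 1) {t : ℝ} (ht : 0 < t) (c : ℝ≥0∞)
    (g : E N → ℝ≥0∞) (x : E N) :
    heatOp s t (fun y => g y + c) x = heatOp s t g x + c := by
  nth_rewrite 2 [← heatOp_const hs0 hs1 ht c x]
  simp only [heatOp, mul_add]
  exact lintegral_add_right _ ((measurable_kernel_sub s t x).mul_const c)

theorem heatOp_add (s t : ℝ) {g : E N → ℝ≥0∞} (hg : AEMeasurable g) (g' : E N → ℝ≥0∞) (x : E N) :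
    heatOp s t (fun y => g y + g' y) x = heatOp s t g x + heatOp s t g' x := by
  simp only [heatOp, mul_add]
  exact lintegral_add_left' ((measurable_kernel_sub s t x).aemeasurable.mul hg) _

theorem heatOp_iSup (s t : ℝ) {g : ℕ → E N → ℝ≥0∞} (hg : ∀ n, Measurable (g n))
    (hmono : Monotone g) (x : E N) :
    heatOp s t (fun y => ⨆ n, g n y) x = ⨆ n, heatOp s t (g n) x := by
  simp only [heatOp, ENNReal.mul_iSup]
  exact lintegral_iSup (fun n => (measurable_kernel_sub s t x).mul (hg n))
    fun n m hnm y => mul_le_mul_right (hmono hnm y) _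

theorem heatOp_lintegral (s t : ℝ) {Ω : Type*} [MeasurableSpace Ω] (μ : Measure Ω) [SFinite μ]
    {G : Ω → E N → ℝ≥0∞} (hG : Measurable fun q : Ω × E N => G q.1 q.2) (x : E N) :
    heatOp s t (fun y => ∫⁻ σ, G σ y ∂μ) x = ∫⁻ σ, heatOp s t (G σ) x ∂μ := by
  have h1 : ∀ y : E N, ENNReal.ofReal (mixedHeatKernel s t (x - y)) * ∫⁻ σ, G σ y ∂μ =
      ∫⁻ σ, ENNReal.ofReal (mixedHeatKernel s t (x - y)) * G σ y ∂μ := fun y => by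
    exact (lintegral_const_mul _ (hG.comp measurable_prodMk_right)).symm
  simp only [heatOp, h1]
  refine lintegral_lintegral_swap (Measurable.aemeasurable ?_)
  exact ((measurable_kernel_sub s t x).comp measurable_fst).mul (hG.comp measurable_swap)

theorem lintegral_heatOp {s : ℝ} (hs0 : 0 < s) (hs1 : s < 1) {t : ℝ} (ht : 0 < t)
    {g : E N → ℝ≥0∞} (hg : AEMeasurable g) : ∫⁻ x, heatOp s t g x = ∫⁻ x, g x := by
  simp only [heatOp]
  rw [lintegral_lintegral_swap]
  · refine lintegral_congr fun y => ?_
    have h1 : Measurable fun x : E N => ENNReal.ofReal (mixedHeatKernel s t (x - y)) :=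
      ((continuous_mixedHeatKernel hs0 ht).comp (continuous_sub_right y)).measurable.ennreal_ofReal
    rw [lintegral_mul_const _ h1,
      lintegral_sub_right_eq_self (fun z => ENNReal.ofReal (mixedHeatKernel s t z)) y,
      lintegral_mixedHeatKernel hs0 hs1 ht, one_mul]
  · refine AEMeasurable.mul (Measurable.aemeasurable ?_) hg.comp_snd
    exact ((continuous_mixedHeatKernel hs0 ht).comp
      (continuous_fst.sub continuous_snd)).measurable.ennreal_ofReal

theorem heatOp_heatOp {s : ℝ} (hs0 : 0 < s) (hs1 : s < 1) {t r : ℝ} (ht : 0 < t) (hr : 0 < r)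
    {g : E N → ℝ≥0∞} (hg : AEMeasurable g) (x : E N) :
    heatOp s t (heatOp s r g) x = heatOp s (t + r) g x := by
  wlog hgm : Measurable g generalizing g
  · have h1 : heatOp s r g = heatOp s r (hg.mk g) := funext (heatOp_congr_ae s r hg.ae_eq_mk)
    rw [h1, heatOp_congr_ae s (t + r) hg.ae_eq_mk]
    exact this hg.measurable_mk.aemeasurable hg.measurable_mk
  have hp : ∀ τ, 0 < τ → Continuous fun q : E N × E N => mixedHeatKernel s τ (q.1 - q.2) :=
    fun τ hτ => (continuous_mixedHeatKernel hs0 hτ).comp (continuous_fst.sub continuous_snd)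
  have h2 : heatOp s t (fun y => ∫⁻ z, ENNReal.ofReal (mixedHeatKernel s r (y - z)) * g z) x =
      ∫⁻ z, heatOp s t (fun y => ENNReal.ofReal (mixedHeatKernel s r (y - z)) * g z) x :=
    heatOp_lintegral s t volume (G := fun z y =>
      ENNReal.ofReal (mixedHeatKernel s r (y - z)) * g z)
      ((((hp r hr).measurable.ennreal_ofReal).comp measurable_swap).mul
        (hgm.comp measurable_fst)) x
  refine h2.trans (lintegral_congr fun z => ?_)
  have h3 : Measurable fun y : E N => ENNReal.ofReal (mixedHeatKernel s r (y - z)) :=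
    ((continuous_mixedHeatKernel hs0 hr).comp (continuous_sub_right z)).measurable.ennreal_ofReal
  simp only [heatOp, ← mul_assoc]
  refine (lintegral_mul_const (g z) ((measurable_kernel_sub s t x).mul h3)).trans ?_
  simp only [Pi.mul_apply]
  congr 1
  -- Translating by `z` turns the integral over `y` into the convolution of kernels at `x - z`.
  have h4 := lintegral_add_right_eq_self (μ := (volume : Measure (E N)))
    (fun y => ENNReal.ofReal (mixedHeatKernel s t (x - y)) *
      ENNReal.ofReal (mixedHeatKernel s r (y - z))) z
  rw [← h4, ← integral_mixedHeatKernel_mul hs0 hs1 ht hr (x - z),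
    ofReal_integral_eq_lintegral_ofReal]
  · refine lintegral_congr fun y => ?_
    rw [ENNReal.ofReal_mul (mixedHeatKernel_nonneg hs0 hs1 ht _), add_sub_cancel_right,
      show x - (y + z) = x - z - y by abel]
  · refine ((integrable_mixedHeatKernel hs0 hs1 hr).mul_const
      (∫ ξ : E N, heatSymbol s t ξ)).mono' ?_ (ae_of_all _ fun y => ?_)
    · exact (((continuous_mixedHeatKernel hs0 ht).comp (continuous_sub_left _)).mul
        (continuous_mixedHeatKernel hs0 hr)).aestronglyMeasurable
    · rw [Real.norm_eq_abs, abs_mul, mul_comm, abs_of_nonneg (mixedHeatKernel_nonneg hs0 hs1 hr y)]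
      exact mul_le_mul_of_nonneg_left (mixedHeatKernel_le hs0 ht _)
        (mixedHeatKernel_nonneg hs0 hs1 hr y)
  · exact ae_of_all _ fun y => mul_nonneg (mixedHeatKernel_nonneg hs0 hs1 ht _)
      (mixedHeatKernel_nonneg hs0 hs1 hr _)

theorem semigroup_eq_toReal_heatOp {s : ℝ} (hs0 : 0 < s) (hs1 : s < 1) {t : ℝ} (ht : 0 < t)
    {v : E N → ℝ} (hv : AEStronglyMeasurable v) (hv0 : ∀ᵐ y, 0 ≤ v y) (x : E N) :
    semigroup s t v x = (heatOp s t (fun y => ENNReal.ofReal (v y)) x).toReal := by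
  have hc : Continuous fun y : E N => mixedHeatKernel s t (x - y) :=
    (continuous_mixedHeatKernel hs0 ht).comp (continuous_sub_left x)
  rw [semigroup, if_pos ht, integral_eq_lintegral_of_nonneg_ae
    (hv0.mono fun y hy => mul_nonneg (mixedHeatKernel_nonneg hs0 hs1 ht _) hy)
    (hc.aestronglyMeasurable.mul hv), heatOp]
  simp only [ENNReal.ofReal_mul (mixedHeatKernel_nonneg hs0 hs1 ht _)]

theorem continuous_semigroup {s : ℝ} (hs0 : 0 < s) {t : ℝ} (ht : 0 < t) {v : E N → ℝ}
    (hv : Integrable v) : Continuous (semigroup s t v) := by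
  have h1 : semigroup s t v = fun x => ∫ y, mixedHeatKernel s t (x - y) * v y := by
    funext x; rw [semigroup, if_pos ht]
  rw [h1]
  have hc := continuous_mixedHeatKernel (N := N) hs0 ht
  refine continuous_of_dominated (bound := fun y => (∫ ξ : E N, heatSymbol s t ξ) * ‖v y‖)
    (fun x => (hc.comp (continuous_sub_left x)).aestronglyMeasurable.mul hv.aestronglyMeasurable)
    (fun x => ae_of_all _ fun y => ?_) (hv.norm.const_mul _) (ae_of_all _ fun y => ?_)
  · rw [norm_mul]
    exact mul_le_mul_of_nonneg_right (mixedHeatKernel_le hs0 ht _) (norm_nonneg _)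
  · exact (hc.comp (continuous_sub_right y)).mul continuous_const

/-! ### The Duhamel term -/

/-- The Duhamel term with source `F`, with values in `[0, ∞]`. -/
def duhamel (s : ℝ) (F : ℝ → E N → ℝ≥0∞) (t : ℝ) (x : E N) : ℝ≥0∞ :=
  ∫⁻ σ in Ioo 0 t, heatOp s (t - σ) (F σ) x

/-- A mild solution is only almost everywhere jointly measurable. The replacement is invisible to
the Duhamel term, since the semigroup sees each slice only up to null sets. -/
theorem exists_measurable_slices {S : Set ℝ} {F : ℝ → E N → ℝ≥0∞}
    (hF : AEMeasurable (fun q : ℝ × E N => F q.1 q.2) ((volume.restrict S).prod volume)) :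
    ∃ F' : ℝ → E N → ℝ≥0∞, Measurable (fun q : ℝ × E N => F' q.1 q.2) ∧
      ∀ᵐ σ ∂volume.restrict S, F σ =ᵐ[volume] F' σ :=
  ⟨fun σ y => hF.mk _ (σ, y), hF.measurable_mk, Measure.ae_ae_of_ae_prod hF.ae_eq_mk⟩

theorem measurable_heatOp_sub (s t : ℝ) {F : ℝ → E N → ℝ≥0∞}
    (hF : Measurable fun q : ℝ × E N => F q.1 q.2) :
    Measurable fun q : ℝ × E N => heatOp s (t - q.1) (F q.1) q.2 :=
  measurable_heatOp_param s (by fun_prop) hF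

theorem duhamel_congr (s : ℝ) {t : ℝ} {F F' : ℝ → E N → ℝ≥0∞}
    (h : ∀ᵐ σ ∂volume.restrict (Ioo 0 t), F σ =ᵐ[volume] F' σ) (x : E N) :
    duhamel s F t x = duhamel s F' t x :=
  lintegral_congr_ae (h.mono fun _ hσ => heatOp_congr_ae _ _ hσ x)

theorem duhamel_mono_ae (s : ℝ) {t : ℝ} {F F' : ℝ → E N → ℝ≥0∞}
    (h : ∀ᵐ σ ∂volume.restrict (Ioo 0 t), ∀ᵐ y, F σ y ≤ F' σ y) (x : E N) :
    duhamel s F t x ≤ duhamel s F' t x :=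
  lintegral_mono_ae (h.mono fun _ hσ => heatOp_mono_ae _ _ hσ x)

theorem aemeasurable_heatOp_sub (s t : ℝ) {S : Set ℝ} {F : ℝ → E N → ℝ≥0∞}
    (hF : AEMeasurable (fun q : ℝ × E N => F q.1 q.2) ((volume.restrict S).prod volume))
    (x : E N) : AEMeasurable (fun σ => heatOp s (t - σ) (F σ) x) (volume.restrict S) := by
  obtain ⟨F', hF', hFF'⟩ := exists_measurable_slices hF
  have h1 : Measurable fun σ : ℝ => (σ, x) := by fun_prop
  have h2 := (measurable_heatOp_sub s t hF').comp h1
  simp only [Function.comp_def] at h2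
  refine ⟨fun σ => heatOp s (t - σ) (F' σ) x, h2, ?_⟩
  filter_upwards [hFF'] with σ hσ using heatOp_congr_ae _ _ hσ x

theorem heatOp_duhamel {s : ℝ} (hs0 : 0 < s) (hs1 : s < 1) {r t : ℝ} (hr : 0 < r)
    {F : ℝ → E N → ℝ≥0∞} (hF : Measurable fun q : ℝ × E N => F q.1 q.2) (x : E N) :
    heatOp s r (duhamel s F t) x = ∫⁻ σ in Ioo 0 t, heatOp s (r + t - σ) (F σ) x := by
  have h1 := heatOp_lintegral s r (volume.restrict (Ioo 0 t))
    (G := fun σ y => heatOp s (t - σ) (F σ) y) (measurable_heatOp_sub s t hF) x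
  refine h1.trans (setLIntegral_congr_fun measurableSet_Ioo fun σ hσ => ?_)
  have h2 : Measurable fun y : E N => (σ, y) := by fun_prop
  rw [add_sub_assoc]
  exact heatOp_heatOp hs0 hs1 hr (sub_pos.2 hσ.2) (g := F σ) (hF.comp h2).aemeasurable x

theorem integral_semigroup_eq_duhamel {s : ℝ} (hs0 : 0 < s) (hs1 : s < 1) {F : ℝ → E N → ℝ}
    {t C : ℝ} (ht : 0 < t)
    (hF : AEStronglyMeasurable (fun q : ℝ × E N => F q.1 q.2)
      ((volume.restrict (Ioo 0 t)).prod volume))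
    (hF0 : ∀ σ ∈ Ioo 0 t, ∀ y, 0 ≤ F σ y)
    (hC : ∀ᵐ σ ∂volume.restrict (Ioo 0 t), ∀ᵐ y, F σ y ≤ C) (x : E N) :
    ∫ σ in (0 : ℝ)..t, semigroup s (t - σ) (F σ) x =
        (duhamel s (fun σ y => ENNReal.ofReal (F σ y)) t x).toReal ∧
      duhamel s (fun σ y => ENNReal.ofReal (F σ y)) t x ≤ ENNReal.ofReal C * ENNReal.ofReal t := by
  have hle : ∀ᵐ σ ∂volume.restrict (Ioo 0 t),
      heatOp s (t - σ) (fun y => ENNReal.ofReal (F σ y)) x ≤ ENNReal.ofReal C := by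
    filter_upwards [hC, ae_restrict_mem measurableSet_Ioo] with σ hσ hσt
    exact heatOp_le_of_ae_le hs0 hs1 (sub_pos.2 hσt.2)
      (hσ.mono fun y hy => ENNReal.ofReal_le_ofReal hy) x
  constructor
  -- The open interval discards `σ = t`, where `semigroup` is the identity by convention but
  -- `heatOp` is not.
  · rw [intervalIntegral.integral_of_le ht.le, integral_Ioc_eq_integral_Ioo, duhamel,
      ← integral_toReal (aemeasurable_heatOp_sub s t hF.aemeasurable.ennreal_ofReal x)
        (hle.mono fun σ hσ => hσ.trans_lt ENNReal.ofReal_lt_top)]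
    refine integral_congr_ae ?_
    filter_upwards [hF.prodMk_left, ae_restrict_mem measurableSet_Ioo] with σ hσ hσt
    exact semigroup_eq_toReal_heatOp hs0 hs1 (sub_pos.2 hσt.2) hσ (ae_of_all _ (hF0 σ hσt)) x
  · refine (lintegral_mono_ae hle).trans_eq ?_
    rw [lintegral_const, Measure.restrict_apply_univ, Real.volume_Ioo, sub_zero]

/-! ### Bounds for mild solutions and their integral equation -/

theorem ae_le_supNorm {v : E N → ℝ} (hv : MemLp v ∞ volume) : ∀ᵐ y, |v y| ≤ supNorm v := by
  filter_upwards [ae_le_eLpNormEssSup (f := v) (μ := volume)] with y hy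
  rw [← eLpNorm_exponent_top] at hy
  have := ENNReal.toReal_mono hv.2.ne hy
  rwa [toReal_enorm, Real.norm_eq_abs] at this

theorem heatOp_ofReal_le_supNorm {s : ℝ} (hs0 : 0 < s) (hs1 : s < 1) {t : ℝ} (ht : 0 < t)
    {v : E N → ℝ} (hv : MemLp v ∞ volume) (x : E N) :
    heatOp s t (fun y => ENNReal.ofReal (v y)) x ≤ ENNReal.ofReal (supNorm v) :=
  heatOp_le_of_ae_le hs0 hs1 ht ((ae_le_supNorm hv).mono fun _ hy =>
    ENNReal.ofReal_le_ofReal ((le_abs_self _).trans hy)) x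

theorem measurableSet_timeInterval (T : EReal) : MeasurableSet (timeInterval T) :=
  (measurableSet_lt measurable_const measurable_id).inter
    (measurableSet_lt measurable_coe_real_ereal measurable_const)

theorem Ioo_subset_timeInterval {T : EReal} {t : ℝ} (ht : t ∈ timeInterval T) :
    Ioo 0 t ⊆ timeInterval T := fun _ hσ =>
  ⟨hσ.1, (EReal.coe_lt_coe_iff.2 hσ.2).trans ht.2⟩

theorem NonnegCont.continuous_max {g : ℝ → ℝ} (hg : NonnegCont g) :
    Continuous fun r => g (max r 0) :=
  hg.1.comp_continuous (by fun_prop) fun _ => mem_Ici.2 (le_max_right _ _)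

theorem NonnegCont.exists_bound {g : ℝ → ℝ} (hg : NonnegCont g) (M : ℝ) :
    ∃ C, 0 ≤ C ∧ ∀ r ∈ Icc 0 M, g r ≤ C := by
  obtain ⟨C, hC⟩ := (isCompact_Icc (a := (0 : ℝ)) (b := M)).exists_bound_of_continuousOn
    (hg.1.mono fun r hr => hr.1)
  exact ⟨max C 0, le_max_right _ _, fun r hr =>
    ((le_abs_self _).trans (hC r hr)).trans (le_max_left _ _)⟩

theorem aestronglyMeasurable_source {h f : ℝ → ℝ} (hh : NonnegCont h) (hf : NonnegCont f)
    {S : Set ℝ} (hS : MeasurableSet S) (hS0 : ∀ t ∈ S, 0 ≤ t) {u : ℝ → E N → ℝ}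
    (hu : AEStronglyMeasurable (fun q : ℝ × E N => u q.1 q.2) ((volume.restrict S).prod volume))
    (hu0 : ∀ t ∈ S, ∀ x, 0 ≤ u t x) :
    AEStronglyMeasurable (fun q : ℝ × E N => h q.1 * f (u q.1 q.2))
      ((volume.restrict S).prod volume) := by
  have h1 : AEStronglyMeasurable (fun q : ℝ × E N => h (max q.1 0) * f (max (u q.1 q.2) 0))
      ((volume.restrict S).prod volume) :=
    (hh.continuous_max.comp continuous_fst).aestronglyMeasurable.mul
      (hf.continuous_max.comp_aestronglyMeasurable hu)
  refine h1.congr ?_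
  have : ∀ᵐ q : ℝ × E N ∂((volume.restrict S).prod volume), q.1 ∈ S :=
    Measure.quasiMeasurePreserving_fst.ae (ae_restrict_mem hS)
  filter_upwards [this] with q hq
  rw [max_eq_left (hS0 _ hq), max_eq_left (hu0 _ hq _)]

theorem MemLinftyX.exists_ae_le {T : EReal} {u : ℝ → E N → ℝ} (hu : MemLinftyX T u) :
    ∃ M, 0 ≤ M ∧ ∀ᵐ t ∂volume.restrict (timeInterval T), ∀ᵐ x, u t x ≤ M := by
  obtain ⟨M, hM⟩ := hu.2.2
  refine ⟨max M 0, le_max_right _ _, hM.mono fun t ht => ?_⟩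
  filter_upwards [ae_le_eLpNormEssSup (f := u t) (μ := volume)] with x hx
  rw [← eLpNorm_exponent_top] at hx
  have h1 := ENNReal.toReal_mono ENNReal.ofReal_ne_top (hx.trans ht.2)
  rw [toReal_enorm, Real.norm_eq_abs, ENNReal.toReal_ofReal'] at h1
  exact (le_abs_self _).trans h1

theorem source_bound {h f : ℝ → ℝ} (hh : NonnegCont h) (hf : NonnegCont f) {t M : ℝ}
    {u : ℝ → E N → ℝ} (hu0 : ∀ σ ∈ Ioo 0 t, ∀ x, 0 ≤ u σ x)
    (hM : ∀ᵐ σ ∂volume.restrict (Ioo 0 t), ∀ᵐ x, u σ x ≤ M) :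
    ∃ C, ∀ᵐ σ ∂volume.restrict (Ioo 0 t), ∀ᵐ y, h σ * f (u σ y) ≤ C := by
  obtain ⟨H, hH0, hH⟩ := hh.exists_bound t
  obtain ⟨B, hB0, hB⟩ := hf.exists_bound M
  refine ⟨H * B, ?_⟩
  filter_upwards [hM, ae_restrict_mem measurableSet_Ioo] with σ hσ hσt
  filter_upwards [hσ] with y hy
  have h0 := hu0 σ hσt y
  exact mul_le_mul (hH σ ⟨hσt.1.le, hσt.2.le⟩) (hB _ ⟨h0, hy⟩) (hf.2 _ h0) hH0

theorem ae_restrict_Ioo_of_timeInterval {T : EReal} {t : ℝ} (ht : t ∈ timeInterval T)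
    {p : ℝ → Prop} (h : ∀ᵐ σ ∂volume.restrict (timeInterval T), p σ) :
    ∀ᵐ σ ∂volume.restrict (Ioo 0 t), p σ :=
  ae_restrict_of_ae_restrict_of_subset (Ioo_subset_timeInterval ht) h

theorem aestronglyMeasurable_Ioo_of_timeInterval {T : EReal} {t : ℝ} (ht : t ∈ timeInterval T)
    {u : ℝ × E N → ℝ}
    (hu : AEStronglyMeasurable u ((volume.restrict (timeInterval T)).prod volume)) :
    AEStronglyMeasurable u ((volume.restrict (Ioo 0 t)).prod volume) :=
  hu.mono_measure (Measure.prod_mono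
    (Measure.restrict_mono (Ioo_subset_timeInterval ht) le_rfl) le_rfl)

theorem IsMildSolution.nonneg {s : ℝ} {h f : ℝ → ℝ} {u₀ : E N → ℝ} {T : EReal}
    {u : ℝ → E N → ℝ} (hu : IsMildSolution s h f u₀ T u) {t : ℝ} (ht : t ∈ timeInterval T)
    (x : E N) : 0 ≤ u t x := hu.1 t ht.1.le ht.2 x

theorem IsMildSolution.aestronglyMeasurable_source {s : ℝ} {h f : ℝ → ℝ} (hh : NonnegCont h)
    (hf : NonnegCont f) {u₀ : E N → ℝ} {T : EReal} {u : ℝ → E N → ℝ}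
    (hu : IsMildSolution s h f u₀ T u) {t : ℝ} (ht : t ∈ timeInterval T) :
    AEStronglyMeasurable (fun q : ℝ × E N => h q.1 * f (u q.1 q.2))
      ((volume.restrict (Ioo 0 t)).prod volume) :=
  MixedHeat.aestronglyMeasurable_source hh hf measurableSet_Ioo (fun _ hσ => hσ.1.le)
    (aestronglyMeasurable_Ioo_of_timeInterval ht hu.2.1.1)
    fun _ hσ => hu.nonneg (Ioo_subset_timeInterval ht hσ)

/-- The integral equation of a mild solution, as an equation between functions with values in
`[0, ∞]`. -/
theorem IsMildSolution.ofReal_eq {s : ℝ} (hs0 : 0 < s) (hs1 : s < 1) {h f : ℝ → ℝ}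
    (hh : NonnegCont h) (hf : NonnegCont f) {u₀ : E N → ℝ} (hu₀ : NonnegX u₀) {T : EReal}
    {u : ℝ → E N → ℝ} (hu : IsMildSolution s h f u₀ T u) {t : ℝ} (ht : t ∈ timeInterval T) :
    ∀ᵐ x, ENNReal.ofReal (u t x) = heatOp s t (fun y => ENNReal.ofReal (u₀ y)) x +
      duhamel s (fun σ y => ENNReal.ofReal (h σ * f (u σ y))) t x := by
  obtain ⟨M, -, hM⟩ := hu.2.1.exists_ae_le
  have hsub := Ioo_subset_timeInterval ht
  obtain ⟨C, hC⟩ := source_bound hh hf (fun σ hσ => hu.nonneg (hsub hσ))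
    (ae_restrict_Ioo_of_timeInterval ht hM)
  filter_upwards [hu.2.2 t ht] with x hx
  obtain ⟨h1, h2⟩ := integral_semigroup_eq_duhamel hs0 hs1 ht.1
    (hu.aestronglyMeasurable_source hh hf ht)
    (fun σ hσ y => mul_nonneg (hh.2 σ hσ.1.le) (hf.2 _ (hu.nonneg (hsub hσ) y))) hC x
  have h3 := heatOp_ofReal_le_supNorm hs0 hs1 ht.1 hu₀.1.2 x
  rw [hx, h1, semigroup_eq_toReal_heatOp hs0 hs1 ht.1 hu₀.1.1.1 hu₀.2,
    ENNReal.ofReal_add ENNReal.toReal_nonneg ENNReal.toReal_nonneg,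
    ENNReal.ofReal_toReal (h3.trans_lt ENNReal.ofReal_lt_top).ne,
    ENNReal.ofReal_toReal (h2.trans_lt (ENNReal.mul_lt_top ENNReal.ofReal_lt_top
      ENNReal.ofReal_lt_top)).ne]

/-! ### Uniqueness -/

/-- The semigroup fixes constants, so an error uniform in space is merely integrated in time. The
additive form avoids subtraction in `[0, ∞]`. -/
theorem duhamel_add_le {s : ℝ} (hs0 : 0 < s) (hs1 : s < 1) {t : ℝ} {F F' : ℝ → E N → ℝ≥0∞}
    {e : ℝ → ℝ≥0∞} (he : Measurable e)
    (h : ∀ᵐ σ ∂volume.restrict (Ioo 0 t), ∀ᵐ y, F σ y ≤ F' σ y + e σ) (x : E N) :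
    duhamel s F t x ≤ duhamel s F' t x + ∫⁻ σ in Ioo 0 t, e σ := by
  rw [duhamel, duhamel, ← lintegral_add_right _ he]
  refine lintegral_mono_ae ?_
  filter_upwards [h, ae_restrict_mem measurableSet_Ioo] with σ hσ hσt
  exact (heatOp_mono_ae _ _ hσ x).trans_eq
    (heatOp_add_const hs0 hs1 (sub_pos.2 hσt.2) _ _ x)

theorem lintegral_pow_div_factorial {A C t : ℝ} (hA : 0 ≤ A) (hC : 0 ≤ C) (ht : 0 ≤ t) (k : ℕ) :
    ∫⁻ σ in Ioo 0 t, ENNReal.ofReal (C * (A * (C * σ) ^ k / k.factorial)) =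
      ENNReal.ofReal (A * (C * t) ^ (k + 1) / (k + 1).factorial) := by
  have hc : Continuous fun σ : ℝ => C * (A * (C * σ) ^ k / k.factorial) := by fun_prop
  rw [← ofReal_integral_eq_lintegral_ofReal
    ((hc.integrableOn_Icc (a := 0) (b := t)).mono_set Ioo_subset_Icc_self)
    ((ae_restrict_mem measurableSet_Ioo).mono fun σ hσ => by
      have := hσ.1.le; simp only [Pi.zero_apply]; positivity)]
  congr 1
  rw [← integral_Ioc_eq_integral_Ioo, ← intervalIntegral.integral_of_le ht]
  have h1 : ∀ σ : ℝ, C * (A * (C * σ) ^ k / k.factorial) =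
      (C * A * C ^ k / k.factorial) * σ ^ k := fun σ => by rw [mul_pow]; ring
  simp_rw [h1]
  rw [intervalIntegral.integral_const_mul, integral_pow, Nat.factorial_succ]
  push_cast
  field_simp
  ring

theorem mildSolutionsUnique {s : ℝ} (hs0 : 0 < s) (hs1 : s < 1) {h f : ℝ → ℝ}
    (hh : NonnegCont h) (hf : NonnegCont f) (hfLip : LocallyLipschitzOn (Ici 0) f)
    {u₀ : E N → ℝ} (hu₀ : NonnegX u₀) : MildSolutionsUnique s h f u₀ := by
  intro T₁ T₂ u₁ u₂ hu₁ hu₂ t₀ ht₁ ht₂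
  obtain ⟨M₁, hM₁0, hM₁⟩ := hu₁.2.1.exists_ae_le
  obtain ⟨M₂, hM₂0, hM₂⟩ := hu₂.2.1.exists_ae_le
  set M := max M₁ M₂ with hM
  obtain ⟨L, hL⟩ := (hfLip.mono (s := Icc 0 M) fun r hr => hr.1).exists_lipschitzOnWith_of_compact
    isCompact_Icc
  obtain ⟨H, hH0, hH⟩ := hh.exists_bound t₀
  set C : ℝ := H * L with hC
  have hC0 : 0 ≤ C := mul_nonneg hH0 L.2
  have hM₁' := ae_restrict_Ioo_of_timeInterval ht₁ hM₁
  have hM₂' := ae_restrict_Ioo_of_timeInterval ht₂ hM₂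
  set e : ℕ → ℝ → ℝ := fun k σ => M * (C * σ) ^ k / k.factorial with he
  have hM0 : 0 ≤ M := hM₁0.trans (le_max_left _ _)
  -- One Duhamel step gains a factor `C t / (k + 1)`. It also turns a bound at almost every time
  -- into one at every time, in particular at `t₀`.
  have step : ∀ k, (∀ᵐ σ ∂volume.restrict (Ioo 0 t₀), ∀ᵐ y, |u₁ σ y - u₂ σ y| ≤ e k σ) →
      ∀ t ∈ Ioc 0 t₀, ∀ᵐ x, |u₁ t x - u₂ t x| ≤ e (k + 1) t := by
    intro k hk t ht
    have hti : ∀ {T : EReal}, t₀ ∈ timeInterval T → t ∈ timeInterval T := fun hT =>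
      ⟨ht.1, (EReal.coe_le_coe_iff.2 ht.2).trans_lt hT.2⟩
    have hsrc : ∀ᵐ σ ∂volume.restrict (Ioo 0 t₀), ∀ᵐ y,
        |h σ * f (u₁ σ y) - h σ * f (u₂ σ y)| ≤ C * e k σ := by
      filter_upwards [hk, hM₁', hM₂', ae_restrict_mem measurableSet_Ioo] with σ h1 h2 h3 hσ
      filter_upwards [h1, h2, h3] with y hy1 hy2 hy3
      have hl := hL.dist_le_mul (u₁ σ y)
        ⟨hu₁.nonneg (Ioo_subset_timeInterval ht₁ hσ) y, hy2.trans (le_max_left _ _)⟩ (u₂ σ y)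
        ⟨hu₂.nonneg (Ioo_subset_timeInterval ht₂ hσ) y, hy3.trans (le_max_right _ _)⟩
      rw [Real.dist_eq, Real.dist_eq] at hl
      rw [← mul_sub, abs_mul, abs_of_nonneg (hh.2 σ hσ.1.le), hC, mul_assoc]
      exact mul_le_mul (hH σ ⟨hσ.1.le, hσ.2.le⟩)
        (hl.trans (mul_le_mul_of_nonneg_left hy1 L.2)) (abs_nonneg _) hH0
    have hsrc' := ae_restrict_of_ae_restrict_of_subset (Ioo_subset_Ioo_right ht.2) hsrc
    have hem : Measurable fun σ => ENNReal.ofReal (C * e k σ) := by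
      simp only [he]; fun_prop
    -- The one-sided estimate is stated for a generic pair so that it can be applied with the two
    -- solutions interchanged.
    have key : ∀ (T T' : EReal) (v w : ℝ → E N → ℝ), IsMildSolution s h f u₀ T v →
        IsMildSolution s h f u₀ T' w → t₀ ∈ timeInterval T → t₀ ∈ timeInterval T' →
        (∀ᵐ σ ∂volume.restrict (Ioo 0 t), ∀ᵐ y,
          |h σ * f (v σ y) - h σ * f (w σ y)| ≤ C * e k σ) →
        ∀ᵐ x, v t x ≤ w t x + e (k + 1) t := by
      intro T T' v w hv hw hT hT' hvw
      filter_upwards [hv.ofReal_eq hs0 hs1 hh hf hu₀ (hti hT),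
        hw.ofReal_eq hs0 hs1 hh hf hu₀ (hti hT')] with x hx1 hx2
      have hd := duhamel_add_le hs0 hs1 (t := t) hem
        (F := fun σ y => ENNReal.ofReal (h σ * f (v σ y)))
        (F' := fun σ y => ENNReal.ofReal (h σ * f (w σ y))) (hvw.mono fun σ hσ =>
          hσ.mono fun y hy => (ENNReal.ofReal_le_ofReal (by
            linarith [(abs_le.1 hy).2])).trans ENNReal.ofReal_add_le) x
      rw [lintegral_pow_div_factorial hM0 hC0 ht.1.le] at hd
      have he0 : 0 ≤ e (k + 1) t := by have := ht.1.le; simp only [he]; positivity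
      have hw0 := hw.nonneg (hti hT') x
      rw [← ENNReal.ofReal_le_ofReal_iff (add_nonneg hw0 he0), ENNReal.ofReal_add hw0 he0, hx1, hx2,
        add_assoc]
      exact add_le_add le_rfl hd
    filter_upwards [key _ _ _ _ hu₁ hu₂ ht₁ ht₂ hsrc', key _ _ _ _ hu₂ hu₁ ht₂ ht₁
      (hsrc'.mono fun σ hσ => hσ.mono fun y hy => by rwa [abs_sub_comm])] with x hx1 hx2
    rw [abs_le]
    constructor <;> linarith
  have hall : ∀ k, ∀ᵐ σ ∂volume.restrict (Ioo 0 t₀), ∀ᵐ y, |u₁ σ y - u₂ σ y| ≤ e k σ := by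
    intro k
    induction k with
    | zero =>
      filter_upwards [hM₁', hM₂', ae_restrict_mem measurableSet_Ioo] with σ h2 h3 hσ
      filter_upwards [h2, h3] with y hy2 hy3
      have h4 := hu₁.nonneg (Ioo_subset_timeInterval ht₁ hσ) y
      have h5 := hu₂.nonneg (Ioo_subset_timeInterval ht₂ hσ) y
      have h6 := le_max_left M₁ M₂
      have h7 := le_max_right M₁ M₂
      simp only [he, pow_zero, mul_one, Nat.factorial_zero, Nat.cast_one, div_one]
      rw [abs_le]
      constructor <;> linarith
    | succ k ih =>
      filter_upwards [ae_restrict_mem measurableSet_Ioo] with σ hσ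
      exact step k ih σ ⟨hσ.1, hσ.2.le⟩
  have hfin : ∀ᵐ x, ∀ k, |u₁ t₀ x - u₂ t₀ x| ≤ e (k + 1) t₀ :=
    ae_all_iff.2 fun k => step k (hall k) t₀ ⟨ht₁.1, le_rfl⟩
  filter_upwards [hfin] with x hx
  have hlim : Tendsto (fun k => e (k + 1) t₀) atTop (𝓝 0) := by
    have := ((FloorSemiring.tendsto_pow_div_factorial_atTop (C * t₀)).const_mul M).comp
      (tendsto_add_atTop_nat 1)
    simpa only [he, mul_div_assoc, mul_zero, Function.comp_def] using this
  exact sub_eq_zero.1 (abs_nonpos_iff.1 (ge_of_tendsto' hlim hx))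

/-! ### Monotone iteration below a supersolution -/

theorem measurable_duhamel_uncurry (s : ℝ) {F : ℝ → E N → ℝ≥0∞}
    (hF : Measurable fun q : ℝ × E N => F q.1 q.2) :
    Measurable fun q : ℝ × E N => duhamel s F q.1 q.2 := by
  have h1 : Measurable fun q : (ℝ × ℝ) × E N => F q.1.2 q.2 := by
    have : Measurable fun q : (ℝ × ℝ) × E N => (q.1.2, q.2) := by fun_prop
    exact hF.comp this
  have h2 := measurable_heatOp_param s (Ω := ℝ × ℝ) (τ := fun p => p.1 - p.2) (by fun_prop)
    (G := fun p => F p.2) h1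
  have h3 : Measurable fun q : (ℝ × E N) × ℝ => ((q.1.1, q.2), q.1.2) := by fun_prop
  -- The domain of integration depends on `t`; as an indicator it becomes part of the integrand.
  have hS : MeasurableSet {q : (ℝ × E N) × ℝ | q.2 ∈ Ioo 0 q.1.1} :=
    (measurableSet_lt measurable_const measurable_snd).inter
      (measurableSet_lt measurable_snd (measurable_fst.comp measurable_fst))
  have h4 := ((h2.comp h3).indicator hS).lintegral_prod_right' (ν := (volume : Measure ℝ))
  have h5 : (fun q : ℝ × E N => duhamel s F q.1 q.2) = fun q : ℝ × E N => ∫⁻ σ,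
      {p : (ℝ × E N) × ℝ | p.2 ∈ Ioo 0 p.1.1}.indicator
        ((fun p : (ℝ × ℝ) × E N => heatOp s (p.1.1 - p.1.2) (F p.1.2) p.2) ∘
          fun p : (ℝ × E N) × ℝ => ((p.1.1, p.2), p.1.2)) (q, σ) := by
    funext q
    rw [duhamel, ← lintegral_indicator measurableSet_Ioo]
    rfl
  rw [h5]
  exact h4

/-- The monotone iteration for the integral equation with nonlinearity `k(t) φ(u)`. -/
def picard (s : ℝ) (k : ℝ → ℝ≥0∞) (φ : ℝ≥0∞ → ℝ≥0∞) (U₀ : E N → ℝ≥0∞) :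
    ℕ → ℝ → E N → ℝ≥0∞
  | 0 => fun _ _ => 0
  | n + 1 => fun t x => heatOp s t U₀ x +
      duhamel s (fun σ y => k σ * φ (picard s k φ U₀ n σ y)) t x

section Picard

variable {s : ℝ} {k : ℝ → ℝ≥0∞} {φ : ℝ≥0∞ → ℝ≥0∞} {U₀ : E N → ℝ≥0∞}

theorem measurable_heatOp_time (s : ℝ) (hU : AEMeasurable U₀) :
    Measurable fun q : ℝ × E N => heatOp s q.1 U₀ q.2 := by
  have h1 : (fun q : ℝ × E N => heatOp s q.1 U₀ q.2) =
      fun q : ℝ × E N => heatOp s q.1 (hU.mk U₀) q.2 :=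
    funext fun q => heatOp_congr_ae s q.1 hU.ae_eq_mk q.2
  rw [h1]
  exact measurable_heatOp_param s measurable_id (G := fun _ => hU.mk U₀)
    (hU.measurable_mk.comp measurable_snd)

theorem measurable_source (hk : Measurable k) (hφ : Measurable φ) {V : ℝ → E N → ℝ≥0∞}
    (hV : Measurable fun q : ℝ × E N => V q.1 q.2) :
    Measurable fun q : ℝ × E N => k q.1 * φ (V q.1 q.2) :=
  (hk.comp measurable_fst).mul (hφ.comp hV)

theorem measurable_picard (hk : Measurable k) (hφ : Measurable φ) (hU : AEMeasurable U₀) (n : ℕ) :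
    Measurable fun q : ℝ × E N => picard s k φ U₀ n q.1 q.2 := by
  induction n with
  | zero => exact measurable_const
  | succ n ih =>
    exact (measurable_heatOp_time s hU).add
      (measurable_duhamel_uncurry s (measurable_source hk hφ ih))

theorem duhamel_mono (s : ℝ) {t : ℝ} {F F' : ℝ → E N → ℝ≥0∞}
    (h : ∀ σ ∈ Ioo 0 t, ∀ y, F σ y ≤ F' σ y) (x : E N) :
    duhamel s F t x ≤ duhamel s F' t x :=
  duhamel_mono_ae s ((ae_restrict_mem measurableSet_Ioo).mono fun σ hσ => ae_of_all _ (h σ hσ)) x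

theorem monotone_picard (hφ : Monotone φ) : Monotone (picard s k φ U₀) := by
  refine monotone_nat_of_le_succ fun n => ?_
  induction n with
  | zero => exact fun _ _ => zero_le
  | succ n ih =>
    exact fun t x => add_le_add le_rfl (duhamel_mono s (fun σ _ y =>
      mul_le_mul_right (hφ (ih σ y)) _) x)

theorem picard_le (hφ : Monotone φ) {T : EReal} {W : ℝ → E N → ℝ≥0∞}
    (hW : ∀ t ∈ timeInterval T, ∀ x, heatOp s t U₀ x +
      duhamel s (fun σ y => k σ * φ (W σ y)) t x ≤ W t x) (n : ℕ) :
    ∀ t ∈ timeInterval T, ∀ x, picard s k φ U₀ n t x ≤ W t x := by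
  induction n with
  | zero => exact fun _ _ _ => zero_le
  | succ n ih =>
    exact fun t ht x => (add_le_add le_rfl (duhamel_mono s (fun σ hσ y =>
      mul_le_mul_right (hφ (ih σ (Ioo_subset_timeInterval ht hσ) y)) _) x)).trans (hW t ht x)

theorem duhamel_iSup (s : ℝ) {F : ℕ → ℝ → E N → ℝ≥0∞}
    (hF : ∀ n, Measurable fun q : ℝ × E N => F n q.1 q.2) (hmono : Monotone F) (t : ℝ) (x : E N) :
    duhamel s (fun σ y => ⨆ n, F n σ y) t x = ⨆ n, duhamel s (F n) t x := by
  have h1 : ∀ σ, heatOp s (t - σ) (fun y => ⨆ n, F n σ y) x =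
      ⨆ n, heatOp s (t - σ) (F n σ) x := fun σ => by
    have h2 : Measurable fun y : E N => (σ, y) := by fun_prop
    exact heatOp_iSup s (t - σ) (fun n => (hF n).comp h2) (fun n m hnm y => hmono hnm σ y) x
  simp only [duhamel, h1]
  have h3 : Measurable fun σ : ℝ => (σ, x) := by fun_prop
  refine lintegral_iSup (fun n => ?_) fun n m hnm σ =>
    heatOp_mono_ae _ _ (ae_of_all _ fun y => hmono hnm σ y) x
  have h4 := (measurable_heatOp_sub s t (hF n)).comp h3
  exact h4

/-- The supremum passes through `φ` by continuity and monotonicity, and through the semigroup and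
the time integral by monotone convergence. No finiteness is needed. -/
theorem iSup_picard_eq (hk : Measurable k) (hφm : Monotone φ) (hφc : Continuous φ)
    (hφ0 : φ 0 = 0) (hU : AEMeasurable U₀) (t : ℝ) (x : E N) :
    ⨆ n, picard s k φ U₀ n t x = heatOp s t U₀ x +
      duhamel s (fun σ y => k σ * φ (⨆ n, picard s k φ U₀ n σ y)) t x := by
  have hmono := monotone_picard (s := s) (k := k) (U₀ := U₀) hφm
  have h1 : ∀ σ y, k σ * φ (⨆ n, picard s k φ U₀ n σ y) =
      ⨆ n, k σ * φ (picard s k φ U₀ n σ y) := fun σ y => by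
    rw [hφm.map_iSup_of_continuousAt hφc.continuousAt hφ0, ENNReal.mul_iSup]
  simp only [h1]
  rw [duhamel_iSup (F := fun n σ y => k σ * φ (picard s k φ U₀ n σ y)) s (fun n => measurable_source hk hφc.measurable
    (measurable_picard hk hφc.measurable hU n)) (fun n m hnm σ y =>
      mul_le_mul_right (hφm (hmono hnm σ y)) _), ENNReal.add_iSup]
  have h2 : ⨆ n, picard s k φ U₀ n t x = ⨆ n, picard s k φ U₀ (n + 1) t x :=
    (Monotone.iSup_nat_add (fun n m hnm => hmono hnm t x) 1).symm
  rw [h2]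
  rfl

end Picard

/-- The nonlinearity `f`, cut off at the level `m`, on `[0, ∞]`. -/
def truncNonlin (f : ℝ → ℝ) (m : ℝ) (r : ℝ≥0∞) : ℝ≥0∞ :=
  ENNReal.ofReal (f (min r (ENNReal.ofReal m)).toReal)

theorem truncNonlin_of_le {f : ℝ → ℝ} {m : ℝ} {r : ℝ≥0∞} (hr : r ≤ ENNReal.ofReal m) :
    truncNonlin f m r = ENNReal.ofReal (f r.toReal) := by
  rw [truncNonlin, min_eq_left hr]

theorem min_toReal_mem_Icc {m : ℝ} (hm : 0 ≤ m) (r : ℝ≥0∞) :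
    (min r (ENNReal.ofReal m)).toReal ∈ Icc 0 m :=
  ⟨ENNReal.toReal_nonneg, ENNReal.toReal_le_of_le_ofReal hm (min_le_right _ _)⟩

/-- The iteration needs a nonlinearity monotone on all of `[0, ∞]`, whereas in (i) `f` is monotone
only up to `m`; hence the cut-off. -/
theorem monotone_truncNonlin {f : ℝ → ℝ} {m : ℝ} (hm : 0 ≤ m) (hf : MonotoneOn f (Icc 0 m)) :
    Monotone (truncNonlin f m) := fun r r' hrr' =>
  ENNReal.ofReal_le_ofReal (hf (min_toReal_mem_Icc hm r) (min_toReal_mem_Icc hm r')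
    (ENNReal.toReal_mono (ne_top_of_le_ne_top ENNReal.ofReal_ne_top (min_le_right _ _))
      (min_le_min_right _ hrr')))

theorem continuous_truncNonlin {f : ℝ → ℝ} (hf : NonnegCont f) (m : ℝ) :
    Continuous (truncNonlin f m) := by
  have h1 : Continuous fun r : ℝ≥0∞ => (min r (ENNReal.ofReal m)).toReal :=
    ENNReal.continuousOn_toReal.comp_continuous (continuous_id.min continuous_const) fun r =>
      ne_top_of_le_ne_top ENNReal.ofReal_ne_top (min_le_right _ _)
  exact ENNReal.continuous_ofReal.comp
    (hf.1.comp_continuous h1 fun r => mem_Ici.2 ENNReal.toReal_nonneg)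

theorem eLpNorm_one_toReal_le {g : E N → ℝ≥0∞} {c : ℝ≥0∞} (hg : ∫⁻ x, g x ≤ c) :
    eLpNorm (fun x => (g x).toReal) 1 volume ≤ c := by
  rw [eLpNorm_one_eq_lintegral_enorm]
  refine (lintegral_mono fun x => ?_).trans hg
  rw [Real.enorm_eq_ofReal ENNReal.toReal_nonneg]
  exact ENNReal.ofReal_toReal_le

theorem eLpNorm_top_toReal_le {g : E N → ℝ≥0∞} {c : ℝ≥0∞} (hg : ∀ x, g x ≤ c) :
    eLpNorm (fun x => (g x).toReal) ∞ volume ≤ c := by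
  rw [eLpNorm_exponent_top]
  refine eLpNormEssSup_le_of_ae_enorm_bound (ae_of_all _ fun x => ?_)
  rw [Real.enorm_eq_ofReal ENNReal.toReal_nonneg]
  exact ENNReal.ofReal_toReal_le.trans (hg x)

/-- Existence of a mild solution below a supersolution `W` of the integral equation. -/
theorem exists_mildSolution_of_supersolution {s : ℝ} (hs0 : 0 < s) (hs1 : s < 1) {h f : ℝ → ℝ}
    (hh : NonnegCont h) (hf : NonnegCont f) (hf0 : f 0 = 0) {m M : ℝ} (hm : 0 ≤ m)
    (hfm : MonotoneOn f (Icc 0 m)) {u₀ : E N → ℝ} (hu₀ : NonnegX u₀) {T : EReal}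
    {W : ℝ → E N → ℝ≥0∞} (hWm : ∀ t ∈ timeInterval T, ∀ x, W t x ≤ ENNReal.ofReal m)
    (hWM : ∀ t ∈ timeInterval T, ∫⁻ x, W t x ≤ ENNReal.ofReal M)
    (hW : ∀ t ∈ timeInterval T, ∀ x, heatOp s t (fun y => ENNReal.ofReal (u₀ y)) x +
      duhamel s (fun σ y => ENNReal.ofReal (h (max σ 0)) * truncNonlin f m (W σ y)) t x ≤ W t x) :
    ∃ u, IsMildSolution s h f u₀ T u ∧ ∀ t ∈ timeInterval T, ∀ x,
      heatOp s t (fun y => ENNReal.ofReal (u₀ y)) x ≤ ENNReal.ofReal (u t x) := by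
  set U₀ : E N → ℝ≥0∞ := fun y => ENNReal.ofReal (u₀ y) with hU₀
  have hU : AEMeasurable U₀ := hu₀.1.1.1.aemeasurable.ennreal_ofReal
  set k : ℝ → ℝ≥0∞ := fun σ => ENNReal.ofReal (h (max σ 0)) with hk
  have hkm : Measurable k := hh.continuous_max.measurable.ennreal_ofReal
  set φ := truncNonlin f m with hφ
  have hφm : Monotone φ := monotone_truncNonlin hm hfm
  have hφc : Continuous φ := continuous_truncNonlin hf m
  have hφ0 : φ 0 = 0 := by simp [hφ, truncNonlin, hf0]
  set U : ℝ → E N → ℝ≥0∞ := fun t x => ⨆ n, picard s k φ U₀ n t x with hUdef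
  have hUm : Measurable fun q : ℝ × E N => U q.1 q.2 :=
    Measurable.iSup fun n => measurable_picard hkm hφc.measurable hU n
  have hUW : ∀ t ∈ timeInterval T, ∀ x, U t x ≤ W t x := fun t ht x =>
    iSup_le fun n => picard_le hφm hW n t ht x
  have hUle : ∀ t ∈ timeInterval T, ∀ x, U t x ≤ ENNReal.ofReal m := fun t ht x =>
    (hUW t ht x).trans (hWm t ht x)
  have hUtop : ∀ t ∈ timeInterval T, ∀ x, U t x ≠ ∞ := fun t ht x =>
    ne_top_of_le_ne_top ENNReal.ofReal_ne_top (hUle t ht x)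
  have hUeq : ∀ t x, U t x = heatOp s t U₀ x + duhamel s (fun σ y => k σ * φ (U σ y)) t x :=
    iSup_picard_eq hkm hφm hφc hφ0 hU
  have hslice : ∀ t, Measurable (U t) := fun t => by
    have : Measurable fun x : E N => (t, x) := by fun_prop
    exact hUm.comp this
  have hnorm : ∀ t ∈ timeInterval T,
      eLpNorm (fun x => (U t x).toReal) 1 volume ≤ ENNReal.ofReal M ∧
      eLpNorm (fun x => (U t x).toReal) ∞ volume ≤ ENNReal.ofReal m := fun t ht =>
    ⟨eLpNorm_one_toReal_le ((lintegral_mono (hUW t ht)).trans (hWM t ht)),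
      eLpNorm_top_toReal_le (hUle t ht)⟩
  refine ⟨fun t x => (U t x).toReal, ⟨fun _ _ _ _ => ENNReal.toReal_nonneg, ⟨?_, ?_, ?_⟩, ?_⟩, ?_⟩
  · exact hUm.ennreal_toReal.aestronglyMeasurable
  · exact fun t ht => ⟨⟨(hslice t).ennreal_toReal.aestronglyMeasurable,
      (hnorm t ht).1.trans_lt ENNReal.ofReal_lt_top⟩,
      ⟨(hslice t).ennreal_toReal.aestronglyMeasurable,
      (hnorm t ht).2.trans_lt ENNReal.ofReal_lt_top⟩⟩
  · refine ⟨max M m, (ae_restrict_mem (measurableSet_timeInterval T)).mono fun t ht => ?_⟩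
    exact ⟨(hnorm t ht).1.trans (ENNReal.ofReal_le_ofReal (le_max_left _ _)),
      (hnorm t ht).2.trans (ENNReal.ofReal_le_ofReal (le_max_right _ _))⟩
  · intro t ht
    refine ae_of_all _ fun x => ?_
    have hsub := Ioo_subset_timeInterval ht
    have hum : AEStronglyMeasurable (fun q : ℝ × E N => (U q.1 q.2).toReal)
        ((volume.restrict (Ioo 0 t)).prod volume) := hUm.ennreal_toReal.aestronglyMeasurable
    have hule : ∀ᵐ σ ∂volume.restrict (Ioo 0 t), ∀ᵐ x, (U σ x).toReal ≤ m :=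
      (ae_restrict_mem measurableSet_Ioo).mono fun σ hσ => ae_of_all _ fun x =>
        ENNReal.toReal_le_of_le_ofReal hm (hUle σ (hsub hσ) x)
    obtain ⟨C, hC⟩ := source_bound hh hf
      (fun σ _ x => ENNReal.toReal_nonneg (a := U σ x)) hule
    obtain ⟨h1, h2⟩ := integral_semigroup_eq_duhamel hs0 hs1 ht.1
      (F := fun σ y => h σ * f (U σ y).toReal)
      (aestronglyMeasurable_source hh hf measurableSet_Ioo (fun _ hσ => hσ.1.le) hum
        fun _ _ _ => ENNReal.toReal_nonneg)
      (fun σ hσ y => mul_nonneg (hh.2 σ hσ.1.le) (hf.2 _ ENNReal.toReal_nonneg)) hC x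
    -- Since `U ≤ W ≤ m`, the cut-off is inactive along the limit, which therefore solves the
    -- original equation.
    have h3 : duhamel s (fun σ y => ENNReal.ofReal (h σ * f (U σ y).toReal)) t x =
        duhamel s (fun σ y => k σ * φ (U σ y)) t x := by
      refine duhamel_congr s ((ae_restrict_mem measurableSet_Ioo).mono fun σ hσ =>
        ae_of_all _ fun y => ?_) x
      simp only [hk, hφ]
      rw [truncNonlin_of_le (hUle σ (hsub hσ) y), max_eq_left hσ.1.le,
        ENNReal.ofReal_mul (hh.2 σ hσ.1.le)]
    rw [h1, h3, semigroup_eq_toReal_heatOp hs0 hs1 ht.1 hu₀.1.1.1 hu₀.2]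
    have h4 := hUtop t ht x
    change (U t x).toReal = _
    rw [hUeq] at h4 ⊢
    exact ENNReal.toReal_add (ENNReal.add_ne_top.1 h4).1 (ENNReal.add_ne_top.1 h4).2
  · intro t ht x
    rw [ENNReal.ofReal_toReal (hUtop t ht x), hUeq]
    exact le_self_add

/-! ### Supremum norms along the semigroup -/

theorem NonnegX.aemeasurable_ofReal {v : E N → ℝ} (hv : NonnegX v) :
    AEMeasurable fun y => ENNReal.ofReal (v y) := hv.1.1.1.aemeasurable.ennreal_ofReal

theorem NonnegX.const_mul {v : E N → ℝ} (hv : NonnegX v) {c : ℝ} (hc : 0 ≤ c) :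
    NonnegX fun x => c * v x :=
  ⟨⟨hv.1.1.const_mul c, hv.1.2.const_mul c⟩, hv.2.mono fun _ hx => mul_nonneg hc hx⟩

theorem lintegral_ofReal_ne_zero {v : E N → ℝ} (hv : NonnegX v)
    (hv0 : ¬ v =ᵐ[volume] 0) : ∫⁻ x, ENNReal.ofReal (v x) ≠ 0 := by
  intro h
  rw [lintegral_eq_zero_iff' hv.aemeasurable_ofReal] at h
  refine hv0 ?_
  filter_upwards [h, hv.2] with x hx hx0
  exact le_antisymm (ENNReal.ofReal_eq_zero.1 hx) hx0

theorem NonnegX.lintegral_ofReal_lt_top {v : E N → ℝ} (hv : NonnegX v) :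
    ∫⁻ x, ENNReal.ofReal (v x) < ∞ :=
  (memLp_one_iff_integrable.1 hv.1.1).lintegral_lt_top

section Semigroup

variable {s : ℝ} {t : ℝ} {v : E N → ℝ}

theorem heatOp_eq_ofReal_semigroup (hs0 : 0 < s) (hs1 : s < 1) (ht : 0 < t) (hv : NonnegX v)
    (x : E N) : heatOp s t (fun y => ENNReal.ofReal (v y)) x =
      ENNReal.ofReal (semigroup s t v x) := by
  rw [semigroup_eq_toReal_heatOp hs0 hs1 ht hv.1.1.1 hv.2, ENNReal.ofReal_toReal]
  exact ((heatOp_ofReal_le_supNorm hs0 hs1 ht hv.1.2 x).trans_lt ENNReal.ofReal_lt_top).ne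

theorem semigroup_nonneg (hs0 : 0 < s) (hs1 : s < 1) (ht : 0 < t) (hv : NonnegX v) (x : E N) :
    0 ≤ semigroup s t v x := by
  rw [semigroup_eq_toReal_heatOp hs0 hs1 ht hv.1.1.1 hv.2]
  exact ENNReal.toReal_nonneg

theorem supNorm_nonneg (v : E N → ℝ) : 0 ≤ supNorm v := ENNReal.toReal_nonneg

theorem semigroup_le_supNorm (hs0 : 0 < s) (hs1 : s < 1) (ht : 0 < t) (hv : NonnegX v)
    (x : E N) : semigroup s t v x ≤ supNorm v := by
  rw [semigroup_eq_toReal_heatOp hs0 hs1 ht hv.1.1.1 hv.2]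
  exact ENNReal.toReal_le_of_le_ofReal (supNorm_nonneg v)
    (heatOp_ofReal_le_supNorm hs0 hs1 ht hv.1.2 x)

theorem supNorm_le_of_ae_le {c : ℝ} (hc : 0 ≤ c) (h : ∀ᵐ x, |v x| ≤ c) : supNorm v ≤ c := by
  refine ENNReal.toReal_le_of_le_ofReal hc ?_
  rw [eLpNorm_exponent_top]
  refine eLpNormEssSup_le_of_ae_enorm_bound (h.mono fun x hx => ?_)
  rw [← ofReal_norm, Real.norm_eq_abs]
  exact ENNReal.ofReal_le_ofReal hx

theorem memLp_top_semigroup (hs0 : 0 < s) (hs1 : s < 1) (ht : 0 < t) (hv : NonnegX v) :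
    MemLp (semigroup s t v) ∞ volume := by
  refine memLp_top_of_bound (C := supNorm v) (continuous_semigroup hs0 ht
    (memLp_one_iff_integrable.1 hv.1.1)).aestronglyMeasurable (ae_of_all _ fun x => ?_)
  rw [Real.norm_eq_abs, abs_of_nonneg (semigroup_nonneg hs0 hs1 ht hv x)]
  exact semigroup_le_supNorm hs0 hs1 ht hv x

theorem ae_semigroup_le_supNorm_semigroup (hs0 : 0 < s) (hs1 : s < 1) (ht : 0 < t)
    (hv : NonnegX v) : ∀ᵐ x, semigroup s t v x ≤ supNorm (semigroup s t v) :=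
  (ae_le_supNorm (memLp_top_semigroup hs0 hs1 ht hv)).mono fun _ hx => (le_abs_self _).trans hx

theorem supNorm_semigroup_le (hs0 : 0 < s) (hs1 : s < 1) (ht : 0 < t) (hv : NonnegX v) :
    supNorm (semigroup s t v) ≤ supNorm v :=
  supNorm_le_of_ae_le (supNorm_nonneg v) (ae_of_all _ fun x => by
    rw [abs_of_nonneg (semigroup_nonneg hs0 hs1 ht hv x)]
    exact semigroup_le_supNorm hs0 hs1 ht hv x)

/-- Mass is conserved, so the evolution of nonzero nonnegative data cannot vanish. -/
theorem supNorm_semigroup_pos (hs0 : 0 < s) (hs1 : s < 1) (ht : 0 < t) (hv : NonnegX v)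
    (hv0 : ¬ v =ᵐ[volume] 0) : 0 < supNorm (semigroup s t v) := by
  by_contra! hle
  refine lintegral_ofReal_ne_zero hv hv0 ?_
  rw [← lintegral_heatOp hs0 hs1 ht hv.aemeasurable_ofReal,
    lintegral_eq_zero_iff' (measurable_heatOp s t hv.aemeasurable_ofReal).aemeasurable]
  filter_upwards [ae_semigroup_le_supNorm_semigroup hs0 hs1 ht hv] with x hx
  rw [heatOp_eq_ofReal_semigroup hs0 hs1 ht hv]
  exact ENNReal.ofReal_eq_zero.2 (hx.trans hle)

end Semigroup

/-! ### Global and local existence -/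

/-- Since `S(t - σ) S(σ) = S(t)`, a source dominated by a scalar multiple of `S(σ) U` contributes
only a scalar integral times `S(t) U`. Both supersolutions are verified this way. -/
theorem duhamel_le_of_source_le {s : ℝ} (hs0 : 0 < s) (hs1 : s < 1) {U : E N → ℝ≥0∞}
    (hU : AEMeasurable U) {t : ℝ} {a b : ℝ → ℝ≥0∞} (ha : ∀ σ, a σ ≠ ∞) (hb : ∀ σ, b σ ≠ ∞)
    {F : ℝ → E N → ℝ≥0∞}
    (hF : ∀ σ ∈ Ioo 0 t, ∀ᵐ y, F σ y ≤ a σ * (b σ * heatOp s σ U y)) {x : E N}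
    (hx : heatOp s t U x ≠ ∞) :
    duhamel s F t x ≤ (∫⁻ σ in Ioo 0 t, a σ * b σ) * heatOp s t U x := by
  rw [← lintegral_mul_const' _ _ hx]
  refine setLIntegral_mono' measurableSet_Ioo fun σ hσ => ?_
  refine (heatOp_mono_ae _ _ (hF σ hσ) x).trans_eq ?_
  rw [heatOp_const_mul _ _ (ha σ), heatOp_const_mul _ _ (hb σ), ← mul_assoc]
  congr 1
  have := heatOp_heatOp hs0 hs1 (sub_pos.2 hσ.2) hσ.1 hU x
  rwa [sub_add_cancel] at this

/-- Global existence for small multiples of `v₀`. -/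
theorem exists_global_mildSolution {s : ℝ} (hs0 : 0 < s) (hs1 : s < 1) {h f : ℝ → ℝ}
    (hh : NonnegCont h) (hf : NonnegCont f) (hf0 : f 0 = 0) {m : ℝ} {v₀ : E N → ℝ}
    (hfm : MonotoneOn f (Ioc 0 m)) (hfr : MonotoneOn (fun r => f r / r) (Ioc 0 m))
    (hv : NonnegX v₀) (hv0 : ¬ v₀ =ᵐ[volume] 0) (hvm : supNorm v₀ ≤ m)
    (hI : ∫⁻ σ in Ioi (0 : ℝ), ENNReal.ofReal (h σ * (f (supNorm (semigroup s σ v₀)) /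
      supNorm (semigroup s σ v₀))) < 1) :
    ∃ δ : ℝ, 0 < δ ∧ ∃ u : ℝ → E N → ℝ,
      IsGlobalMildSolution s h f (fun x => δ * v₀ x) u ∧ IsNontrivial u := by
  set I := ∫⁻ σ in Ioi (0 : ℝ), ENNReal.ofReal (h σ * (f (supNorm (semigroup s σ v₀)) /
      supNorm (semigroup s σ v₀))) with hIdef
  set V : E N → ℝ≥0∞ := fun y => ENNReal.ofReal (v₀ y) with hV
  have hm : 0 ≤ m := (supNorm_nonneg v₀).trans hvm
  have hI1 : I.toReal < 1 := by
    rw [← ENNReal.toReal_one]; exact ENNReal.toReal_strict_mono ENNReal.one_ne_top hI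
  have hδ : 0 < 1 - I.toReal := sub_pos.2 hI1
  -- The largest multiple for which `δ S(t) v₀ + I S(t) v₀ ≤ S(t) v₀` is guaranteed.
  set δ := 1 - I.toReal with hδdef
  have hδI : ENNReal.ofReal δ + I = 1 := by
    rw [← ENNReal.ofReal_toReal (hI.trans ENNReal.one_lt_top).ne,
      ← ENNReal.ofReal_add hδ.le ENNReal.toReal_nonneg, hδdef, sub_add_cancel, ENNReal.ofReal_one]
  have hfm' : MonotoneOn f (Icc 0 m) := by
    intro r hr r' hr' hrr'
    rcases hr.1.eq_or_lt with h0 | h0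
    · rw [← h0, hf0]; exact hf.2 _ hr'.1
    · exact hfm ⟨h0, hr.2⟩ ⟨h0.trans_le hrr', hr'.2⟩ hrr'
  have hVm : ∀ t, 0 < t → ∀ x, heatOp s t V x ≤ ENNReal.ofReal m := fun t ht x =>
    (heatOp_ofReal_le_supNorm hs0 hs1 ht hv.1.2 x).trans (ENNReal.ofReal_le_ofReal hvm)
  have hU₀ : ∀ t x, heatOp s t (fun y => ENNReal.ofReal (δ * v₀ y)) x =
      ENNReal.ofReal δ * heatOp s t V x := fun t x => by
    simp only [ENNReal.ofReal_mul hδ.le]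
    exact heatOp_const_mul s t ENNReal.ofReal_ne_top _ _
  obtain ⟨u, hu, huV⟩ := exists_mildSolution_of_supersolution hs0 hs1 hh hf hf0 hm hfm'
    (hv.const_mul hδ.le) (T := ⊤) (W := fun t x => heatOp s t V x)
    (M := (∫⁻ x, V x).toReal) (fun t ht x => hVm t ht.1 x)
    (fun t ht => by
      rw [lintegral_heatOp hs0 hs1 ht.1 hv.aemeasurable_ofReal,
        ENNReal.ofReal_toReal hv.lintegral_ofReal_lt_top.ne])
    (fun t ht x => by
      have hfin : heatOp s t V x ≠ ∞ := ne_top_of_le_ne_top ENNReal.ofReal_ne_top (hVm t ht.1 x)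
      have hsrc : ∀ σ ∈ Ioo 0 t, ∀ᵐ y, ENNReal.ofReal (h (max σ 0)) *
          truncNonlin f m (heatOp s σ V y) ≤ 1 * (ENNReal.ofReal (h σ *
            (f (supNorm (semigroup s σ v₀)) / supNorm (semigroup s σ v₀))) * heatOp s σ V y) := by
        intro σ hσ
        have hR0 := supNorm_semigroup_pos hs0 hs1 hσ.1 hv hv0
        have hRm := (supNorm_semigroup_le hs0 hs1 hσ.1 hv).trans hvm
        filter_upwards [ae_semigroup_le_supNorm_semigroup hs0 hs1 hσ.1 hv] with y hy
        rw [truncNonlin_of_le (hVm σ hσ.1 y), max_eq_left hσ.1.le, one_mul,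
          heatOp_eq_ofReal_semigroup hs0 hs1 hσ.1 hv,
          ENNReal.ofReal_mul (hh.2 σ hσ.1.le), mul_assoc,
          ENNReal.toReal_ofReal (semigroup_nonneg hs0 hs1 hσ.1 hv y),
          ← ENNReal.ofReal_mul (div_nonneg (hf.2 _ hR0.le) hR0.le)]
        refine mul_le_mul_right (ENNReal.ofReal_le_ofReal ?_) _
        -- Monotonicity of `f(r)/r` compares the value at `y` with the supremum norm; it is
        -- available only for `r > 0`, and at a zero `f 0 = 0` suffices.
        rcases (semigroup_nonneg hs0 hs1 hσ.1 hv y).eq_or_lt with h0 | h0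
        · rw [← h0, hf0, mul_zero]
        · exact (div_le_iff₀ h0).1 (hfr ⟨h0, hy.trans hRm⟩ ⟨hR0, hRm⟩ hy)
      have hd := duhamel_le_of_source_le hs0 hs1 hv.aemeasurable_ofReal
        (fun _ => ENNReal.one_ne_top) (fun _ => ENNReal.ofReal_ne_top) hsrc hfin
      simp only [one_mul] at hd
      have hle : ∫⁻ σ in Ioo 0 t, ENNReal.ofReal (h σ * (f (supNorm (semigroup s σ v₀)) /
          supNorm (semigroup s σ v₀))) ≤ I := lintegral_mono_set fun σ hσ => hσ.1
      rw [hU₀]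
      calc _ ≤ ENNReal.ofReal δ * heatOp s t V x + I * heatOp s t V x :=
            add_le_add le_rfl (hd.trans (mul_le_mul_left hle _))
        _ = heatOp s t V x := by rw [← add_mul, hδI, one_mul])
  -- The solution dominates `δ S(t) v₀`, so its vanishing at one positive time would force the
  -- conserved mass of `v₀` to be zero.
  refine ⟨δ, hδ, u, hu, fun hzero => ?_⟩
  have hne : (ae (volume.restrict (Ioi (0 : ℝ)))).NeBot := by
    rw [ae_neBot, Ne, Measure.restrict_eq_zero, Real.volume_Ioi]
    exact ENNReal.top_ne_zero
  obtain ⟨t, ht, ht0⟩ := (hzero.and (ae_restrict_mem measurableSet_Ioi)).exists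
  refine lintegral_ofReal_ne_zero hv hv0 ?_
  rw [← lintegral_heatOp hs0 hs1 ht0 hv.aemeasurable_ofReal,
    lintegral_eq_zero_iff' (measurable_heatOp s t hv.aemeasurable_ofReal).aemeasurable]
  filter_upwards [ht] with x hx
  have h1 := huV t ⟨ht0, EReal.coe_lt_top t⟩ x
  rw [hU₀, hx, Pi.zero_apply, ENNReal.ofReal_zero, nonpos_iff_eq_zero, mul_eq_zero] at h1
  exact h1.resolve_left (ENNReal.ofReal_pos.2 hδ).ne'

theorem exists_linear_bound {f : ℝ → ℝ} (hf0 : f 0 = 0) (hfLip : LocallyLipschitzOn (Ici 0) f)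
    (m : ℝ) : ∃ L, 0 ≤ L ∧ ∀ r ∈ Icc 0 m, f r ≤ L * r := by
  obtain ⟨L, hL⟩ := (hfLip.mono (s := Icc 0 m) fun r hr => hr.1).exists_lipschitzOnWith_of_compact
    isCompact_Icc
  refine ⟨L, L.2, fun r hr => ?_⟩
  have h1 := hL.dist_le_mul r hr 0 ⟨le_rfl, hr.1.trans hr.2⟩
  rw [Real.dist_eq, Real.dist_eq, hf0, sub_zero, sub_zero, abs_of_nonneg hr.1] at h1
  exact (le_abs_self _).trans h1

theorem lintegral_exp_mul {C t : ℝ} (hC : 0 ≤ C) (ht : 0 ≤ t) :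
    ∫⁻ σ in Ioo 0 t, ENNReal.ofReal C * ENNReal.ofReal (Real.exp (C * σ)) =
      ENNReal.ofReal (Real.exp (C * t) - 1) := by
  have hc : Continuous fun σ : ℝ => C * Real.exp (C * σ) := by fun_prop
  simp only [← ENNReal.ofReal_mul hC]
  rw [← ofReal_integral_eq_lintegral_ofReal
    ((hc.integrableOn_Icc (a := 0) (b := t)).mono_set Ioo_subset_Icc_self)
    (ae_of_all _ fun σ => mul_nonneg hC (Real.exp_pos _).le)]
  congr 1
  rw [← integral_Ioc_eq_integral_Ioo, ← intervalIntegral.integral_of_le ht]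
  have hd : ∀ σ ∈ uIcc 0 t, HasDerivAt (fun σ => Real.exp (C * σ)) (C * Real.exp (C * σ)) σ := by
    intro σ _
    have := ((hasDerivAt_id σ).const_mul C).exp
    simpa [mul_comm] using this
  rw [intervalIntegral.integral_eq_sub_of_hasDerivAt hd (hc.intervalIntegrable 0 t)]
  simp

/-- Local existence of mild solutions for nondecreasing locally Lipschitz nonlinearities. -/
theorem exists_local_mildSolution {s : ℝ} (hs0 : 0 < s) (hs1 : s < 1) {h f : ℝ → ℝ}
    (hh : NonnegCont h) (hf : NonnegCont f) (hfLip : LocallyLipschitzOn (Ici 0) f)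
    (hf0 : f 0 = 0) (hfm : MonotoneOn f (Ici 0)) {u₀ : E N → ℝ} (hu₀ : NonnegX u₀) :
    ∃ T : EReal, 0 < T ∧ ∃ u : ℝ → E N → ℝ, IsMildSolution s h f u₀ T u := by
  set V : E N → ℝ≥0∞ := fun y => ENNReal.ofReal (u₀ y) with hV
  set K := supNorm u₀ with hK
  have hK0 : 0 ≤ K := supNorm_nonneg u₀
  obtain ⟨L, hL0, hL⟩ := exists_linear_bound hf0 hfLip (K + 1)
  obtain ⟨H, hH0, hH⟩ := hh.exists_bound 1
  obtain ⟨C, hC⟩ : ∃ C, C = H * L := ⟨_, rfl⟩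
  have hC0 : 0 ≤ C := hC ▸ mul_nonneg hH0 hL0
  have hcont : Tendsto (fun t : ℝ => Real.exp (C * t) * K) (𝓝 0) (𝓝 K) := by
    have : Continuous fun t : ℝ => Real.exp (C * t) * K := by fun_prop
    simpa using this.tendsto 0
  -- Before `min τ 1` the supersolution `exp (C t) S(t) u₀` stays below `K + 1`, where `L` is valid,
  -- and `t` stays below `1`, where `H` is valid.
  obtain ⟨τ, hτ0, hτ⟩ := Metric.eventually_nhds_iff.1 (hcont.eventually_lt_const (lt_add_one K))
  have hbound : ∀ t ∈ timeInterval ((min τ 1 : ℝ) : EReal),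
      0 < t ∧ t < 1 ∧ Real.exp (C * t) * K ≤ K + 1 := by
    intro t ht
    have h1 := EReal.coe_lt_coe_iff.1 ht.2
    refine ⟨ht.1, h1.trans_le (min_le_right _ _), (hτ ?_).le⟩
    rw [Real.dist_eq, sub_zero, abs_of_pos ht.1]
    exact h1.trans_le (min_le_left _ _)
  have hWm : ∀ t ∈ timeInterval ((min τ 1 : ℝ) : EReal), ∀ x,
      ENNReal.ofReal (Real.exp (C * t)) * heatOp s t V x ≤ ENNReal.ofReal (K + 1) := by
    intro t ht x
    refine (mul_le_mul_right (heatOp_ofReal_le_supNorm hs0 hs1 ht.1 hu₀.1.2 x) _).trans ?_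
    rw [← ENNReal.ofReal_mul (Real.exp_pos _).le]
    exact ENNReal.ofReal_le_ofReal (hbound t ht).2.2
  obtain ⟨u, hu, -⟩ := exists_mildSolution_of_supersolution hs0 hs1 hh hf hf0
    (m := K + 1) (by linarith) (hfm.mono fun r hr => hr.1) hu₀ (T := ((min τ 1 : ℝ) : EReal))
    (W := fun t x => ENNReal.ofReal (Real.exp (C * t)) * heatOp s t V x)
    (M := Real.exp C * (∫⁻ x, V x).toReal) hWm
    (fun t ht => by
      rw [lintegral_const_mul _ (measurable_heatOp s t hu₀.aemeasurable_ofReal),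
        lintegral_heatOp hs0 hs1 ht.1 hu₀.aemeasurable_ofReal, ENNReal.ofReal_mul
        (Real.exp_pos _).le, ENNReal.ofReal_toReal hu₀.lintegral_ofReal_lt_top.ne]
      refine mul_le_mul_left (ENNReal.ofReal_le_ofReal (Real.exp_le_exp.2 ?_)) _
      exact mul_le_of_le_one_right hC0 (hbound t ht).2.1.le)
    (fun t ht x => by
      have hfin : heatOp s t V x ≠ ∞ := ne_top_of_le_ne_top ENNReal.ofReal_ne_top
        (heatOp_ofReal_le_supNorm hs0 hs1 ht.1 hu₀.1.2 x)
      have hsrc : ∀ σ ∈ Ioo 0 t, ∀ᵐ y, ENNReal.ofReal (h (max σ 0)) *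
          truncNonlin f (K + 1) (ENNReal.ofReal (Real.exp (C * σ)) * heatOp s σ V y) ≤
          ENNReal.ofReal C * (ENNReal.ofReal (Real.exp (C * σ)) * heatOp s σ V y) := by
        intro σ hσ
        refine ae_of_all _ fun y => ?_
        have hle := hWm σ (Ioo_subset_timeInterval ht hσ) y
        have hle2 := ENNReal.toReal_le_of_le_ofReal (by linarith) hle
        rw [truncNonlin_of_le hle, max_eq_left hσ.1.le,
          show ENNReal.ofReal C = ENNReal.ofReal H * ENNReal.ofReal L by
            rw [hC, ENNReal.ofReal_mul hH0],
          mul_assoc]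
        refine mul_le_mul' (ENNReal.ofReal_le_ofReal
          (hH σ ⟨hσ.1.le, (hσ.2.trans (hbound t ht).2.1).le⟩)) ?_
        refine (ENNReal.ofReal_le_ofReal (hL _ ⟨ENNReal.toReal_nonneg, hle2⟩)).trans ?_
        rw [ENNReal.ofReal_mul hL0]
        exact mul_le_mul_right ENNReal.ofReal_toReal_le _
      have hd := duhamel_le_of_source_le hs0 hs1 hu₀.aemeasurable_ofReal
        (fun _ => ENNReal.ofReal_ne_top) (fun _ => ENNReal.ofReal_ne_top) hsrc hfin
      rw [lintegral_exp_mul hC0 ht.1.le] at hd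
      have h1 : 0 ≤ Real.exp (C * t) - 1 :=
        sub_nonneg.2 (Real.one_le_exp (mul_nonneg hC0 ht.1.le))
      calc _ ≤ 1 * heatOp s t V x + ENNReal.ofReal (Real.exp (C * t) - 1) * heatOp s t V x := by
            rw [one_mul]; exact add_le_add le_rfl hd
        _ = _ := by
            rw [← add_mul, ← ENNReal.ofReal_one, ← ENNReal.ofReal_add zero_le_one h1,
              add_sub_cancel])
  refine ⟨_, ?_, u, hu⟩
  exact_mod_cast lt_min hτ0 one_pos

/-! ### Scalar comparison and the gap estimate -/

/-- Comparison for the integral inequality `g(t) ≥ A + ∫₀ᵗ h f(g)`. -/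
theorem integral_le_integral_one_div {h f g : ℝ → ℝ} (hh : NonnegCont h) (hf : NonnegCont f)
    (hfm : MonotoneOn f (Ici 0)) (hfpos : ∀ r, 0 < r → 0 < f r) {A κ : ℝ} (hA : 0 < A)
    (hκ : 0 < κ) (hg : ContinuousOn g (Icc 0 κ)) (hgA : ∀ t ∈ Icc 0 κ, A ≤ g t)
    (hint : ∀ t ∈ Icc 0 κ, A + ∫ σ in (0 : ℝ)..t, h σ * f (g σ) ≤ g t) :
    ∫ σ in (0 : ℝ)..κ, h σ ≤ ∫ r in A..g κ, 1 / f r := by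
  -- Clamping time to `[0, κ]` makes all integrands continuous on `ℝ`, so the primitives are
  -- differentiable at every point.
  set c : ℝ → ℝ := fun t => max 0 (min t κ) with hc
  have hcc : Continuous c := by fun_prop
  have hcm : ∀ t, c t ∈ Icc 0 κ := fun t => ⟨le_max_left _ _, max_le hκ.le (min_le_right _ _)⟩
  have hce : ∀ t ∈ Icc 0 κ, c t = t := fun t ht => by
    simp only [hc]; rw [min_eq_left ht.2, max_eq_right ht.1]
  have hgc : Continuous fun t => g (c t) := hg.comp_continuous hcc hcm
  have hg0 : ∀ t, 0 ≤ g (c t) := fun t => hA.le.trans (hgA _ (hcm t))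
  have hhc : Continuous fun t => h (c t) := hh.1.comp_continuous hcc fun t => (hcm t).1
  set p : ℝ → ℝ := fun t => h (c t) * f (g (c t)) with hp
  have hpc : Continuous p := hhc.mul (hf.1.comp_continuous hgc hg0)
  have hp0 : ∀ t, 0 ≤ p t := fun t => mul_nonneg (hh.2 _ (hcm t).1) (hf.2 _ (hg0 t))
  set y : ℝ → ℝ := fun t => A + ∫ σ in (0 : ℝ)..t, p σ with hy
  have hyd : ∀ t, HasDerivAt y (p t) t := fun t =>
    (hpc.integral_hasStrictDerivAt 0 t).hasDerivAt.const_add A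
  have hyA : ∀ t, 0 ≤ t → A ≤ y t := fun t ht =>
    le_add_of_nonneg_right (intervalIntegral.integral_nonneg ht fun σ _ => hp0 σ)
  have hyg : ∀ t ∈ Icc 0 κ, y t ≤ g t := fun t ht => by
    refine le_trans (le_of_eq ?_) (hint t ht)
    simp only [hy]
    congr 1
    refine intervalIntegral.integral_congr fun σ hσ => ?_
    rw [uIcc_of_le ht.1] at hσ
    simp only [hp]
    rw [hce σ ⟨hσ.1, hσ.2.trans ht.2⟩]
  set q : ℝ → ℝ := fun r => 1 / f (max r A) with hq
  have hmA : ∀ r, 0 < max r A := fun r => hA.trans_le (le_max_right _ _)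
  have hqc : Continuous q := continuous_const.div
    (hf.1.comp_continuous (by fun_prop) fun r => mem_Ici.2 (hmA r).le)
    fun r => (hfpos _ (hmA r)).ne'
  have hqe : ∀ b, A ≤ b → ∫ r in A..b, q r = ∫ r in A..b, 1 / f r := fun b hb => by
    refine intervalIntegral.integral_congr fun r hr => ?_
    rw [uIcc_of_le hb] at hr
    simp only [hq]
    rw [max_eq_left hr.1]
  -- On `[0, κ]` the derivative is `h (f(g)/f(y) - 1)`, nonnegative because `y ≤ g` and `f` is
  -- nondecreasing. Passing through `y` avoids differentiating `g`, which is only continuous.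
  set D : ℝ → ℝ := fun t => (∫ r in A..y t, q r) - ∫ σ in (0 : ℝ)..t, h (c σ) with hD
  have hDd : ∀ t, HasDerivAt D (q (y t) * p t - h (c t)) t := fun t =>
    ((hqc.integral_hasStrictDerivAt A (y t)).hasDerivAt.comp t (hyd t)).sub
      (hhc.integral_hasStrictDerivAt 0 t).hasDerivAt
  have hmono : MonotoneOn D (Icc 0 κ) := by
    refine monotoneOn_of_deriv_nonneg (convex_Icc 0 κ)
      (fun t _ => (hDd t).continuousAt.continuousWithinAt)
      (fun t _ => (hDd t).differentiableAt.differentiableWithinAt) fun t ht => ?_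
    have ht' := interior_subset ht
    rw [(hDd t).deriv, sub_nonneg]
    have h1 := hyA t ht'.1
    simp only [hq, hp]
    rw [max_eq_left h1, hce t ht', one_div_mul_eq_div, le_div_iff₀ (hfpos _ (hA.trans_le h1))]
    exact mul_le_mul_of_nonneg_left (hfm (mem_Ici.2 (hA.le.trans h1))
      (mem_Ici.2 (hA.le.trans (hgA t ht'))) (hyg t ht')) (hh.2 _ ht'.1)
  have h2 := hmono (left_mem_Icc.2 hκ.le) (right_mem_Icc.2 hκ.le) hκ.le
  have hD0 : D 0 = 0 := by simp [hD, hy]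
  rw [hD0] at h2
  have h3 : ∫ σ in (0 : ℝ)..κ, h (c σ) = ∫ σ in (0 : ℝ)..κ, h σ := by
    refine intervalIntegral.integral_congr fun σ hσ => ?_
    rw [uIcc_of_le hκ.le] at hσ
    rw [hce σ hσ]
  have h4 : ∫ r in A..y κ, q r ≤ ∫ r in A..g κ, q r := by
    refine intervalIntegral.integral_mono_interval le_rfl (hyA κ hκ.le)
      (hyg κ (right_mem_Icc.2 hκ.le)) (ae_of_all _ fun r => ?_) (hqc.intervalIntegrable _ _)
    exact one_div_nonneg.2 (hfpos _ (hmA r)).le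
  rw [← h3, ← hqe _ (hgA κ (right_mem_Icc.2 hκ.le))]
  simp only [hD] at h2
  linarith

/-- If `∫_A^b 1/f` dominates `∫_K^∞ 1/f` for `A` in `[K/2, K]`, then `A` stays away from `K`. -/
theorem exists_gap {f : ℝ → ℝ} (hfm : MonotoneOn f (Ici 0)) (hfpos : ∀ r, 0 < r → 0 < f r)
    (hfi : ∀ z, 0 < z → IntegrableOn (fun r => 1 / f r) (Ioi z)) {K : ℝ} (hK : 0 < K) (M : ℝ) :
    ∃ η, 0 < η ∧ ∀ A b, K / 2 ≤ A → A ≤ K → A ≤ b → b ≤ M →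
      ∫ r in Ioi K, 1 / f r ≤ ∫ r in A..b, 1 / f r → A ≤ K - η := by
  set B := max M K with hB
  have hB0 : 0 < B := hK.trans_le (le_max_right _ _)
  have hpos : ∀ z, 0 < z → ∀ r ∈ Ioi z, 0 < 1 / f r := fun z hz r hr =>
    one_div_pos.2 (hfpos r (hz.trans hr))
  have hII : ∀ z, 0 < z → ∀ w, z ≤ w → IntervalIntegrable (fun r => 1 / f r) volume z w :=
    fun z hz w hw => (intervalIntegrable_iff_integrableOn_Ioc_of_le hw).2
      ((hfi z hz).mono_set Ioc_subset_Ioi_self)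
  set c := ∫ r in Ioi B, 1 / f r with hc
  have hc0 : 0 < c := by
    rw [hc, setIntegral_pos_iff_support_of_nonneg_ae
      ((ae_restrict_mem measurableSet_Ioi).mono fun r hr => (hpos B hB0 r hr).le) (hfi B hB0)]
    have hsub : Ioi B ⊆ Function.support fun r => 1 / f r := fun r hr => (hpos B hB0 r hr).ne'
    rw [inter_eq_self_of_subset_right hsub]
    simp
  -- Cancelling `∫_K^B 1/f` leaves `c ≤ ∫_A^K 1/f ≤ (K - A)/f(K/2)`. The restriction `A ≥ K/2` is
  -- what bounds `1/f` uniformly.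
  refine ⟨c * f (K / 2), mul_pos hc0 (hfpos _ (half_pos hK)), fun A b hA hAK hAb hbM hle => ?_⟩
  have hA0 : 0 < A := (half_pos hK).trans_le hA
  have hbB : b ≤ B := hbM.trans (le_max_left _ _)
  have hKB : K ≤ B := le_max_right _ _
  have h1 : ∫ r in A..b, 1 / f r ≤ ∫ r in A..B, 1 / f r :=
    intervalIntegral.integral_mono_interval le_rfl hAb hbB
      ((ae_restrict_mem measurableSet_Ioc).mono fun r hr => (hpos A hA0 r hr.1).le)
      (hII A hA0 B (hAb.trans hbB))
  have h2 : ∫ r in A..B, 1 / f r = (∫ r in A..K, 1 / f r) + ∫ r in K..B, 1 / f r :=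
    (intervalIntegral.integral_add_adjacent_intervals (hII A hA0 K hAK) (hII K hK B hKB)).symm
  have h3 : ∫ r in Ioi K, 1 / f r = (∫ r in K..B, 1 / f r) + c := by
    rw [intervalIntegral.integral_of_le hKB, hc, ← setIntegral_union
      (Ioc_disjoint_Ioi le_rfl) measurableSet_Ioi
      ((hfi K hK).mono_set Ioc_subset_Ioi_self) (hfi B hB0), Ioc_union_Ioi_eq_Ioi hKB]
  have hfK : 0 < f (K / 2) := hfpos _ (half_pos hK)
  have h4 : ∫ r in A..K, 1 / f r ≤ ∫ _ in A..K, 1 / f (K / 2) := by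
    refine intervalIntegral.integral_mono_on hAK (hII A hA0 K hAK) (by simp) fun r hr => ?_
    exact one_div_le_one_div_of_le hfK (hfm (mem_Ici.2 (half_pos hK).le)
      (mem_Ici.2 (hA0.le.trans hr.1)) (hA.trans hr.1))
  rw [intervalIntegral.integral_const, smul_eq_mul, mul_one_div] at h4
  have h5 : c ≤ (K - A) / f (K / 2) := by linarith
  rw [le_div_iff₀ hfK] at h5
  linarith

/-! ### Nonexistence beyond `κ` -/

section Blowup

variable {s : ℝ} {h f : ℝ → ℝ} {u₀ : E N → ℝ} {T : EReal} {u : ℝ → E N → ℝ}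

theorem IsMildSolution.nonnegX (hu : IsMildSolution s h f u₀ T u) {t : ℝ}
    (ht : t ∈ timeInterval T) : NonnegX (u t) :=
  ⟨hu.2.1.2.1 t ht, ae_of_all _ (hu.nonneg ht)⟩

/-- On the range of a bounded `w`, the Lipschitz property and `f 0 = 0` give `f(w) ≤ L w`, which
yields integrability as well as boundedness. -/
theorem NonnegX.comp_nonlin (hf : NonnegCont f) (hf0 : f 0 = 0)
    (hfLip : LocallyLipschitzOn (Ici 0) f) {w : E N → ℝ} (hw : NonnegX w)
    (hw0 : ∀ x, 0 ≤ w x) : NonnegX fun x => f (w x) := by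
  obtain ⟨L, hL0, hL⟩ := exists_linear_bound hf0 hfLip (supNorm w)
  have hm : AEStronglyMeasurable (fun x => f (w x)) volume := by
    have := hf.continuous_max.comp_aestronglyMeasurable hw.1.1.1
    exact this.congr (ae_of_all _ fun x => by
      change f (max (w x) 0) = _
      rw [max_eq_left (hw0 x)])
  have hle : ∀ᵐ x, ‖f (w x)‖ ≤ ‖L * w x‖ := by
    filter_upwards [ae_le_supNorm hw.1.2] with x hx
    rw [Real.norm_eq_abs, Real.norm_eq_abs, abs_of_nonneg (hf.2 _ (hw0 x)),
      abs_of_nonneg (mul_nonneg hL0 (hw0 x))]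
    exact hL _ ⟨hw0 x, (le_abs_self _).trans hx⟩
  exact ⟨⟨(hw.1.1.const_mul L).mono hm hle, (hw.1.2.const_mul L).mono hm hle⟩,
    ae_of_all _ fun x => hf.2 _ (hw0 x)⟩

/-- Both sides are continuous in `x`, so the exceptional set is open and null, hence empty.
Otherwise it would depend on time, and no single `x` could be fixed for the scalar inequality. -/
theorem jensen_everywhere (hs0 : 0 < s) (hs1 : s < 1) (hf : NonnegCont f) (hf0 : f 0 = 0)
    (hfLip : LocallyLipschitzOn (Ici 0) f) {t : ℝ} (ht : 0 < t) {w : E N → ℝ} (hw : NonnegX w)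
    (hw0 : ∀ x, 0 ≤ w x)
    (hJ : ∀ᵐ x, f (semigroup s t w x) ≤ semigroup s t (fun y => f (w y)) x) (x : E N) :
    f (semigroup s t w x) ≤ semigroup s t (fun y => f (w y)) x := by
  have h1 : Continuous fun x => f (semigroup s t w x) := hf.1.comp_continuous
    (continuous_semigroup hs0 ht (memLp_one_iff_integrable.1 hw.1.1))
    fun x => mem_Ici.2 (semigroup_nonneg hs0 hs1 ht hw x)
  have h2 : Continuous (semigroup s t fun y => f (w y)) := continuous_semigroup hs0 ht
    (memLp_one_iff_integrable.1 (hw.comp_nonlin hf hf0 hfLip hw0).1.1)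
  by_contra! hlt
  have hopen : IsOpen {x | semigroup s t (fun y => f (w y)) x < f (semigroup s t w x)} :=
    isOpen_lt h2 h1
  refine (hopen.measure_pos volume ⟨x, hlt⟩).ne' ?_
  simpa only [not_le] using ae_iff.1 hJ

/-- Mild solutions do not exist beyond a time `κ` at which the blow-up condition holds. -/
theorem IsMildSolution.le_of_blowup_condition (hs0 : 0 < s) (hs1 : s < 1) (hh : NonnegCont h)
    (hf : NonnegCont f) (hfLip : LocallyLipschitzOn (Ici 0) f) (hf0 : f 0 = 0)
    (hu₀ : NonnegX u₀) (hu₀0 : ¬ u₀ =ᵐ[volume] 0) (hfm : MonotoneOn f (Ici 0))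
    (hfpos : ∀ r, 0 < r → 0 < f r)
    (hfi : ∀ z, 0 < z → IntegrableOn (fun r => 1 / f r) (Ioi z))
    (hJ : ∀ t : ℝ, 0 < t → ∀ w : E N → ℝ, NonnegX w →
      ∀ᵐ x, f (semigroup s t w x) ≤ semigroup s t (fun y => f (w y)) x)
    {κ : ℝ} (hκ : 0 < κ)
    (hblow : ∫ r in Ioi (supNorm (semigroup s κ u₀)), 1 / f r ≤ ∫ σ in (0 : ℝ)..κ, h σ)
    (hu : IsMildSolution s h f u₀ T u) : T ≤ (κ : EReal) := by
  by_contra! hκT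
  have hκm : κ ∈ timeInterval T := ⟨hκ, hκT⟩
  have hsub := Ioo_subset_timeInterval hκm
  set U₀ : E N → ℝ≥0∞ := fun y => ENNReal.ofReal (u₀ y) with hU₀
  have hU₀m : AEMeasurable U₀ := hu₀.aemeasurable_ofReal
  set F : ℝ → E N → ℝ≥0∞ := fun σ y => ENNReal.ofReal (h σ * f (u σ y)) with hF
  obtain ⟨F', hF'm, hFF'⟩ := exists_measurable_slices (F := F)
    (hu.aestronglyMeasurable_source hh hf hκm).aemeasurable.ennreal_ofReal
  obtain ⟨M, -, hM⟩ := hu.2.1.exists_ae_le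
  obtain ⟨C, hC⟩ := source_bound hh hf (fun σ hσ => hu.nonneg (hsub hσ))
    (ae_restrict_Ioo_of_timeInterval hκm hM)
  set ψ : E N → ℝ → ℝ≥0∞ := fun x σ => heatOp s (κ - σ) (F' σ) x with hψ
  have hψm : ∀ x, Measurable (ψ x) := fun x => by
    have h1 : Measurable fun σ : ℝ => (σ, x) := by fun_prop
    have h2 := (measurable_heatOp_sub s κ hF'm).comp h1
    exact h2
  have hψC : ∀ x, ∀ᵐ σ ∂volume.restrict (Ioo 0 κ), ψ x σ ≤ ENNReal.ofReal C := fun x => by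
    filter_upwards [hC, hFF', ae_restrict_mem measurableSet_Ioo] with σ h1 h2 hσ
    refine heatOp_le_of_ae_le hs0 hs1 (sub_pos.2 hσ.2) ?_ x
    filter_upwards [h1, h2] with y hy1 hy2
    rw [← hy2]
    exact ENNReal.ofReal_le_ofReal hy1
  -- For `0 < t < κ` this is the solution at time `t` evolved freely up to `κ`. Defining it by the
  -- integral formula covers the endpoints too: `S(κ) u₀` at `t = 0` and `u(κ)` at `t = κ`.
  set G : ℝ → E N → ℝ≥0∞ := fun t x => heatOp s κ U₀ x + ∫⁻ σ in Ioo 0 t, ψ x σ with hG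
  have hduh : ∀ t ∈ Ioc 0 κ, ∀ x, duhamel s F t x = duhamel s F' t x := fun t ht x =>
    duhamel_congr s (ae_restrict_of_ae_restrict_of_subset (Ioo_subset_Ioo_right ht.2) hFF') x
  have hpush : ∀ t ∈ Ioo 0 κ, ∀ x,
      heatOp s (κ - t) (fun y => ENNReal.ofReal (u t y)) x = G t x := by
    intro t ht x
    have hκt : 0 < κ - t := sub_pos.2 ht.2
    have h1 : (fun y => ENNReal.ofReal (u t y)) =ᵐ[volume]
        fun y => heatOp s t U₀ y + duhamel s F' t y := by
      filter_upwards [hu.ofReal_eq hs0 hs1 hh hf hu₀ (hsub ht)] with y hy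
      rw [hy, hduh t ⟨ht.1, ht.2.le⟩]
    rw [heatOp_congr_ae _ _ h1, heatOp_add _ _ (measurable_heatOp s t hU₀m).aemeasurable,
      heatOp_heatOp hs0 hs1 hκt ht.1 hU₀m, heatOp_duhamel hs0 hs1 hκt hF'm, sub_add_cancel]
  have hend : ∀ᵐ x, ENNReal.ofReal (u κ x) = G κ x := by
    filter_upwards [hu.ofReal_eq hs0 hs1 hh hf hu₀ hκm] with x hx
    rw [hx, hduh κ ⟨hκ, le_rfl⟩]
    rfl
  have hjen : ∀ᵐ σ ∂volume.restrict (Ioo 0 κ), ∀ x,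
      ENNReal.ofReal (h σ * f (G σ x).toReal) ≤ ψ x σ := by
    filter_upwards [hFF', ae_restrict_mem measurableSet_Ioo] with σ h1 hσ x
    have hκσ : 0 < κ - σ := sub_pos.2 hσ.2
    have hw := hu.nonnegX (hsub hσ)
    have hw0 := hu.nonneg (hsub hσ)
    have h2 := jensen_everywhere hs0 hs1 hf hf0 hfLip hκσ hw hw0 (hJ _ hκσ _ hw) x
    rw [semigroup_eq_toReal_heatOp hs0 hs1 hκσ hw.1.1.1 hw.2, hpush σ hσ] at h2
    rw [ENNReal.ofReal_mul (hh.2 σ hσ.1.le)]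
    refine (mul_le_mul_right (ENNReal.ofReal_le_ofReal h2) _).trans_eq ?_
    rw [← heatOp_eq_ofReal_semigroup hs0 hs1 hκσ (hw.comp_nonlin hf hf0 hfLip hw0),
      ← heatOp_const_mul _ _ ENNReal.ofReal_ne_top]
    simp only [← ENNReal.ofReal_mul (hh.2 σ hσ.1.le)]
    exact heatOp_congr_ae _ _ h1 x
  set K := supNorm (semigroup s κ u₀) with hK
  have hK0 : 0 < K := supNorm_semigroup_pos hs0 hs1 hκ hu₀ hu₀0
  obtain ⟨η, hη0, hη⟩ := exists_gap hfm hfpos hfi hK0 (supNorm (u κ))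
  -- This bound is strictly below `K`, the essential supremum of the same function, which is the
  -- contradiction. Points with value below `K / 2` satisfy it trivially; at the others the scalar
  -- comparison applies.
  have hgap : ∀ᵐ x, |semigroup s κ u₀ x| ≤ max (K / 2) (K - η) := by
    filter_upwards [hend, ae_le_supNorm (hu.2.1.2.1 κ hκm).2,
      ae_semigroup_le_supNorm_semigroup hs0 hs1 hκ hu₀] with x hx1 hx2 hx3
    rw [abs_of_nonneg (semigroup_nonneg hs0 hs1 hκ hu₀ x)]
    set A := semigroup s κ u₀ x with hA
    rcases lt_or_ge A (K / 2) with hlt | hge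
    · exact hlt.le.trans (le_max_left _ _)
    refine le_trans ?_ (le_max_right _ _)
    have hA0 : 0 < A := (half_pos hK0).trans_le hge
    set ρ : ℝ → ℝ := fun σ => (ψ x σ).toReal with hρ
    have hρ0 : ∀ σ, 0 ≤ ρ σ := fun σ => ENNReal.toReal_nonneg
    have hρi : IntegrableOn ρ (Ioo 0 κ) := by
      refine Measure.integrableOn_of_bounded (M := (ENNReal.ofReal C).toReal)
        (by simp) (hψm x).ennreal_toReal.aestronglyMeasurable ?_
      filter_upwards [hψC x] with σ hσ
      rw [Real.norm_eq_abs, abs_of_nonneg (hρ0 σ)]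
      exact ENNReal.toReal_mono ENNReal.ofReal_ne_top hσ
    have hρii : IntervalIntegrable ρ volume 0 κ :=
      (intervalIntegrable_iff_integrableOn_Ioo_of_le hκ.le).2 hρi
    have hGr : ∀ t ∈ Icc 0 κ, (G t x).toReal = A + ∫ σ in (0 : ℝ)..t, ρ σ := by
      intro t ht
      have hψt := ae_restrict_of_ae_restrict_of_subset (Ioo_subset_Ioo_right ht.2) (hψC x)
      have h1 : ∫⁻ σ in Ioo 0 t, ψ x σ ≠ ∞ := by
        refine ((lintegral_mono_ae hψt).trans_lt ?_).ne
        rw [lintegral_const, Measure.restrict_apply_univ, Real.volume_Ioo]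
        exact ENNReal.mul_lt_top ENNReal.ofReal_lt_top ENNReal.ofReal_lt_top
      simp only [hG]
      rw [heatOp_eq_ofReal_semigroup hs0 hs1 hκ hu₀, ENNReal.toReal_add ENNReal.ofReal_ne_top h1,
        ENNReal.toReal_ofReal hA0.le, intervalIntegral.integral_of_le ht.1,
        integral_Ioc_eq_integral_Ioo, integral_toReal (hψm x).aemeasurable
          (hψt.mono fun σ hσ => hσ.trans_lt ENNReal.ofReal_lt_top)]
    set g : ℝ → ℝ := fun t => A + ∫ σ in (0 : ℝ)..t, ρ σ with hg
    have hgc : ContinuousOn g (Icc 0 κ) := by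
      have := intervalIntegral.continuousOn_primitive_interval'
        hρii (left_mem_uIcc)
      rw [uIcc_of_le hκ.le] at this
      exact continuousOn_const.add this
    have hgA : ∀ t ∈ Icc 0 κ, A ≤ g t := fun t ht =>
      le_add_of_nonneg_right (intervalIntegral.integral_nonneg ht.1 fun σ _ => hρ0 σ)
    have hgint : ∀ t ∈ Icc 0 κ, A + ∫ σ in (0 : ℝ)..t, h σ * f (g σ) ≤ g t := by
      intro t ht
      refine add_le_add le_rfl ?_
      rw [intervalIntegral.integral_of_le ht.1, intervalIntegral.integral_of_le ht.1,
        integral_Ioc_eq_integral_Ioo, integral_Ioc_eq_integral_Ioo]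
      have hsubt : Ioo 0 t ⊆ Ioo 0 κ := Ioo_subset_Ioo_right ht.2
      refine integral_mono_of_nonneg ?_ (hρi.mono_set hsubt) ?_
      · filter_upwards [ae_restrict_mem measurableSet_Ioo] with σ hσ
        exact mul_nonneg (hh.2 σ hσ.1.le)
          (hf.2 _ (hA0.le.trans (hgA σ ⟨hσ.1.le, (hσ.2.trans_le ht.2).le⟩)))
      · filter_upwards [ae_restrict_of_ae_restrict_of_subset hsubt hjen,
          ae_restrict_of_ae_restrict_of_subset hsubt (hψC x),
          ae_restrict_mem measurableSet_Ioo] with σ h1 h2 hσ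
        have h3 := h1 x
        rw [hGr σ ⟨hσ.1.le, (hσ.2.trans_le ht.2).le⟩] at h3
        exact (ENNReal.ofReal_le_iff_le_toReal (h2.trans_lt ENNReal.ofReal_lt_top).ne).1 h3
    have hcmp := integral_le_integral_one_div hh hf hfm hfpos hA0 hκ hgc hgA hgint
    have hκκ : κ ∈ Icc 0 κ := ⟨hκ.le, le_rfl⟩
    have hgM : g κ ≤ supNorm (u κ) := by
      rw [hg]
      simp only
      rw [← hGr κ hκκ, ← hx1, ENNReal.toReal_ofReal (hu.nonneg hκm x)]
      exact (le_abs_self _).trans hx2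
    exact hη A (g κ) hge hx3 (hgA κ hκκ) hgM (hblow.trans hcmp)
  have hlast := supNorm_le_of_ae_le ((half_pos hK0).le.trans (le_max_left _ _)) hgap
  have : max (K / 2) (K - η) < K := max_lt (half_lt_self hK0) (sub_lt_self K hη0)
  exact absurd hlast (not_le.2 this)

end Blowup

end MixedHeat

end

theorem theorem3p1 (N : ℕ) (hN : 1 ≤ N) (s : ℝ) (hs0 : 0 < s) (hs1 : s < 1)
    (h f : ℝ → ℝ) (hh : MixedHeat.NonnegCont h) (hf : MixedHeat.NonnegCont f)
    (hfLip : LocallyLipschitzOn (Set.Ici 0) f) (hf0 : f 0 = 0) :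
    -- (i) global existence
    (∀ (m : ℝ) (v₀ : MixedHeat.E N → ℝ),
      MonotoneOn f (Set.Ioc 0 m) →
      MonotoneOn (fun r => f r / r) (Set.Ioc 0 m) →
      MixedHeat.NonnegX v₀ →
      ¬ v₀ =ᵐ[MeasureTheory.volume] 0 →
      MixedHeat.supNorm v₀ ≤ m →
      ∫⁻ σ in Set.Ioi (0 : ℝ), ENNReal.ofReal
          (h σ * (f (MixedHeat.supNorm (MixedHeat.semigroup s σ v₀)) /
            MixedHeat.supNorm (MixedHeat.semigroup s σ v₀))) < 1 →
      ∃ δ : ℝ, 0 < δ ∧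
        MixedHeat.MildSolutionsUnique s h f (fun x => δ * v₀ x) ∧
        ∃ u : ℝ → MixedHeat.E N → ℝ,
          MixedHeat.IsGlobalMildSolution s h f (fun x => δ * v₀ x) u ∧
          MixedHeat.IsNontrivial u) ∧
    -- (ii) nonglobal existence
    (∀ u₀ : MixedHeat.E N → ℝ,
      MixedHeat.NonnegX u₀ →
      ¬ u₀ =ᵐ[MeasureTheory.volume] 0 →
      MonotoneOn f (Set.Ici 0) →
      (∀ r : ℝ, 0 < r → 0 < f r) →
      (∀ z : ℝ, 0 < z → MeasureTheory.IntegrableOn (fun r => 1 / f r) (Set.Ioi z)) →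
      (∀ t : ℝ, 0 < t → ∀ w : MixedHeat.E N → ℝ, MixedHeat.NonnegX w →
        ∀ᵐ x : MixedHeat.E N,
          f (MixedHeat.semigroup s t w x) ≤ MixedHeat.semigroup s t (fun y => f (w y)) x) →
      ∀ κ : ℝ, 0 < κ →
        ∫ r in Set.Ioi (MixedHeat.supNorm (MixedHeat.semigroup s κ u₀)), 1 / f r
          ≤ ∫ σ in (0 : ℝ)..κ, h σ →
        -- the mild solution exists locally, is unique, and is not global:
        -- its interval of existence cannot exceed `[0,κ]`
        (∃ T : EReal, 0 < T ∧ ∃ u : ℝ → MixedHeat.E N → ℝ,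
          MixedHeat.IsMildSolution s h f u₀ T u) ∧
        MixedHeat.MildSolutionsUnique s h f u₀ ∧
        (∀ (T : EReal) (u : ℝ → MixedHeat.E N → ℝ),
          MixedHeat.IsMildSolution s h f u₀ T u → T ≤ (κ : EReal)) ∧
        ¬ ∃ u : ℝ → MixedHeat.E N → ℝ, MixedHeat.IsGlobalMildSolution s h f u₀ u) := by

  refine ⟨fun m v₀ hfm hfr hv hv0 hvm hI => ?_, fun u₀ hu₀ hu₀0 hfm hfpos hfi hJ κ hκ hblow => ?_⟩
  · obtain ⟨δ, hδ, u, hu, hu0⟩ :=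
      MixedHeat.exists_global_mildSolution hs0 hs1 hh hf hf0 hfm hfr hv hv0 hvm hI
    exact ⟨δ, hδ, MixedHeat.mildSolutionsUnique hs0 hs1 hh hf hfLip (hv.const_mul hδ.le),
      u, hu, hu0⟩
  · have hle : ∀ (T : EReal) (u : ℝ → MixedHeat.E N → ℝ),
        MixedHeat.IsMildSolution s h f u₀ T u → T ≤ (κ : EReal) := fun T u hu =>
      hu.le_of_blowup_condition hs0 hs1 hh hf hfLip hf0 hu₀ hu₀0 hfm hfpos hfi hJ hκ hblow
    refine ⟨MixedHeat.exists_local_mildSolution hs0 hs1 hh hf hfLip hf0 hfm hu₀,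
      MixedHeat.mildSolutionsUnique hs0 hs1 hh hf hfLip hu₀, hle, ?_⟩
    rintro ⟨u, hu⟩
    exact absurd (hle ⊤ u hu) (not_le.2 (EReal.coe_lt_top κ))
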